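/- Let $G$ be a finitely generated group with a finite, non-empty, symmetric generating set $S$ and identity $e$. Let $|g|$ be the word length of $g\in G$ (the distance from $e$ to $g$ in the Cayley graph of $(G,S)$) and $B_n=\{g\in G: |g|\le n\}$. Let $P=\tfrac12\left(\delta_e+\mathbf 1_S/|S|\right)$ be the step distribution of the lazy random walk and $P^{(n)}$ its $n$-th convolution power. Put $$\mathbb E|P^{(n)}|=\sum_{g\in G}|g|\,P^{(n)}(g),\qquad H(P^{(n)})=-\sum_{g\in G}P^{(n)}(g)\ln P^{(n)}(g),$$ and let $$\beta=\sup\{c\in[0,1] : \exists K>0\ \forall n\ge 1,\ \mathbb E|P^{(n)}|\ge K n^{c}\}.$$ An equivariant uniform embedding of $G$ is a map $f:G\to B$ into a real Hilbert space $B$ on which $G$ acts by (affine) isometries $\pi(g)$, such that $f(gx)=\pi(g)f(x)$ for all $g,x\in G$, together with an unbounded non-decreasing function $\rho_-:\mathbb R_{\ge 0}\to\mathbb R_{\ge 0}$ and a constant $C>0$ such that $$\rho_-(|y^{-1}x|)\le\|f(x)-f(y)\|\le C|y^{-1}x|+C\qquad\text{for all }x,y\in G.$$ The exponent of $\rho_-$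 is $\sup\{c\in[0,1] : \exists K>0\ \forall n\ge1,\ \rho_-(n)\ge Kn^{c}\}$, and the equivariant (Hilbertian) compression exponent $\alpha(G)$ is the supremum of these exponents over all equivariant uniform embeddings of $G$. All suprema are taken in $[0,1]$, so the supremum of the empty set is $0$. Assume that there are $K,L>0$ and $\nu\in(0,1]$ with $|B_n|\le L e^{K n^{\nu}}$ for all integers $n\ge 0$. Then: (a) There are constants $K',K'',L''>0$ such that $\mathbb E|P^{(n)}|\le K' n^{1/(2-\nu)}$ and $H(P^{(n)})\le L''+K'' n^{\nu/(2-\nu)}$ for all $n\ge 0$; hence also $\beta\le 1/(2-\nu)$. (b) $\alpha(G)\ge 1-\nu$. (c) For every $h\in\mathbb R$: if there are $K',L'>0$ such that $H(P^{(n)})\ge K'+L' n^{h}$ for all $n\ge 1$, then $\beta\nu\ge h$ and $2h\,\alpha(G)\le\nu$. -/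

import Mathlib

open scoped NNReal

universe u

noncomputable section

namespace LazyWalk

variable {G : Type u} [Group G]

/-! ### Cayley graph, word length, balls -/

/-- The word length `|g|`: the distance from the identity to `g` in the Cayley graph of `G` whose
edges join `x` to `x * s` for `s ∈ S`. -/
def wordLength (S : Finset G) (g : G) : ℕ :=
  (SimpleGraph.mulCayley (S : Set G)).dist 1 g

/-- The ball of radius `n` about the identity. -/
def ball (S : Finset G) (n : ℕ) : Set G :=
  {g | wordLength S g ≤ n}

/-! ### The lazy random walk -/

/-- The one-step distribution `P = (δ_e + 1_S / |S|) / 2` of the lazy random walk. Finitely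
supported functions on `G` under convolution are the elements of the monoid algebra. -/
def lazyStep (S : Finset G) : MonoidAlgebra ℝ G :=
  (1 / 2 : ℝ) • (MonoidAlgebra.single 1 1 +
    ((S.card : ℝ)⁻¹) • ∑ s ∈ S, MonoidAlgebra.single s 1)

/-- The `n`-step distribution `P^(n)`, i.e. the `n`-th convolution power of `P`. -/
def walk (S : Finset G) (n : ℕ) : MonoidAlgebra ℝ G :=
  lazyStep S ^ n

/-- The speed (drift) `E|P^(n)| = ∑_g P^(n)(g) |g|`. -/
def speed (S : Finset G) (n : ℕ) : ℝ :=
  ∑ g ∈ (walk S n).coeff.support, (walk S n).coeff g * (wordLength S g : ℝ)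

/-- The entropy `H(P^(n)) = -∑_g P^(n)(g) ln P^(n)(g)`; the terms with `P^(n)(g) = 0` vanish. -/
def entropy (S : Finset G) (n : ℕ) : ℝ :=
  -∑ g ∈ (walk S n).coeff.support, (walk S n).coeff g * Real.log ((walk S n).coeff g)

/-- The speed exponent `β`: the supremum of all `c ∈ [0,1]` with `E|P^(n)| ≥ K n^c` for some
`K > 0` and all `n ≥ 1`. -/
def speedExponent (S : Finset G) : ℝ :=
  sSup {c : ℝ | c ∈ Set.Icc (0 : ℝ) 1 ∧
    ∃ K : ℝ, 0 < K ∧ ∀ n : ℕ, 1 ≤ n → K * (n : ℝ) ^ c ≤ speed S n}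

/-! ### Equivariant Hilbertian compression -/

/-- `f : G → B` is an equivariant uniform embedding for the action `π` of `G` on `B` by (not
necessarily linear) isometries, with lower compression function `ρ`. -/
structure IsEquivariantUniformEmbedding (S : Finset G) {B : Type*} [NormedAddCommGroup B]
    (π : G →* (B ≃ᵢ B)) (f : G → B) (ρ : ℝ≥0 → ℝ≥0) : Prop where
  monotone : Monotone ρ
  unbounded : ¬ BddAbove (Set.range ρ)
  lower : ∀ x y : G, (ρ (wordLength S (y⁻¹ * x) : ℝ≥0) : ℝ) ≤ ‖f x - f y‖
  upper : ∃ C : ℝ, 0 < C ∧ ∀ x y : G, ‖f x - f y‖ ≤ C * (wordLength S (y⁻¹ * x) : ℝ) + C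
  equivariant : ∀ g x : G, f (g * x) = π g (f x)

/-- The exponent of a compression function: the supremum of all `c ∈ [0,1]` with `ρ(n) ≥ K n^c`
for some `K > 0` and all `n ≥ 1`. -/
def exponentOf (ρ : ℝ≥0 → ℝ≥0) : ℝ :=
  sSup {c : ℝ | c ∈ Set.Icc (0 : ℝ) 1 ∧
    ∃ K : ℝ, 0 < K ∧ ∀ n : ℕ, 1 ≤ n → K * (n : ℝ) ^ c ≤ (ρ (n : ℝ≥0) : ℝ)}

/-- The equivariant Hilbertian compression exponent `α(G)`: the supremum of the exponents of all
equivariant uniform embeddings of `G` into real Hilbert spaces (it is `0` if there are none).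
The universe of the Hilbert space does not matter: the closed affine span of the image of an
embedding is invariant, and it is separable because `G` is countable. -/
def compressionExponent (S : Finset G) : ℝ :=
  sSup {a : ℝ | ∃ (B : Type u) (_ : NormedAddCommGroup B) (_ : InnerProductSpace ℝ B)
    (_ : CompleteSpace B) (π : G →* (B ≃ᵢ B)) (f : G → B) (ρ : ℝ≥0 → ℝ≥0),
    IsEquivariantUniformEmbedding S π f ρ ∧ a = exponentOf ρ}

end LazyWalk

end

/-! Write $X_n$ for the walk at time $n$. Two inequalities between drift and entropy carry (a). In
the weight $e^{2a|x|}$ one lazy step multiplies the squared $\ell^2$ norm by at most $\cosh^2 a\le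
e^{a^2}$, so $\sum_x e^{2a|x|}P^{(n)}(x)^2\le e^{a^2n}$, and Jensen's inequality gives $2a\,\mathbb
E|X_n|\le a^2n+H(P^{(n)})$ (`two_mul_speed_le`). Conversely, comparing $P^{(n)}$ with a Gibbs
measure proportional to $e^{-2KR^{\nu-1}|x|}$ bounds $H(P^{(n)})$ by $2KR^{\nu-1}\mathbb
E|X_n|+CR^\nu$ for every $R\ge1$ (`exists_entropy_le`). With $a=2KR^{\nu-1}$ the drift term of the
second bound is half that of the first, so it can be absorbed; $R=n^{1/(2-\nu)}$ balances the rest.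

For (b), truncated exponentials at scale $R$ are unit vectors $\varphi_R\in\ell^2(G)$ supported in
$B_R$ which each generator moves by $O(R^{\nu-1})$ (`exists_almost_invariant`). Weighting them by
$R^{1-\nu}$, up to a logarithm, over dyadic $R$ and taking the direct sum gives a formal vector
whose coboundary is in $\ell^2$. An element of length about $2R$ makes the supports at scale $R$
disjoint, so its cocycle has norm at least that weight (`exists_cocycle_growth`).

For (c), the second inequality with $R=\max(1,\mathbb E|X_n|)$ turns entropy growth $n^h$ into drift
growth $n^{h/\nu}$ (`exists_le_speed`). For an equivariant $f$ into a Hilbert space, $\mathbb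
E\|f(1)-f(X_n)\|^2$ grows at most linearly in $n$ (`sum_walk_mul_norm_sub_sq_le`), so compression
exponent $c\ge1/2$ and drift exponent $d$ satisfy $2cd\le1$. -/

namespace LazyWalk

/-! ### Word length and finiteness of balls -/

section WordLength

variable {G : Type u} [Group G] (S : Finset G)

theorem dist_mul_left_le (hS : (SimpleGraph.mulCayley (S : Set G)).Connected) (g x y : G) :
    (SimpleGraph.mulCayley (S : Set G)).dist (g * x) (g * y) ≤
      (SimpleGraph.mulCayley (S : Set G)).dist x y := by
  obtain ⟨p, hp⟩ := (hS x y).exists_walk_length_eq_dist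
  let φ : SimpleGraph.mulCayley (S : Set G) →g SimpleGraph.mulCayley (S : Set G) :=
    ⟨fun z => g * z, fun h => SimpleGraph.mulCayley_adj_mul_iff_right.2 h⟩
  rw [← hp, ← SimpleGraph.Walk.length_map φ p]
  exact SimpleGraph.dist_le _

theorem dist_eq_wordLength (hS : (SimpleGraph.mulCayley (S : Set G)).Connected) (x y : G) :
    (SimpleGraph.mulCayley (S : Set G)).dist x y = wordLength S (x⁻¹ * y) := by
  unfold wordLength
  apply le_antisymm
  · simpa using dist_mul_left_le S hS x 1 (x⁻¹ * y)
  · simpa using dist_mul_left_le S hS x⁻¹ x y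

@[simp] theorem wordLength_one : wordLength S (1 : G) = 0 := by simp [wordLength]

theorem wordLength_inv (hS : (SimpleGraph.mulCayley (S : Set G)).Connected) (g : G) :
    wordLength S g⁻¹ = wordLength S g := by
  have := dist_eq_wordLength S hS g 1
  rw [mul_one] at this
  rw [← this, SimpleGraph.dist_comm, wordLength]

theorem wordLength_mul_le (hS : (SimpleGraph.mulCayley (S : Set G)).Connected) (g h : G) :
    wordLength S (g * h) ≤ wordLength S g + wordLength S h := by
  have h1 := hS.dist_triangle (u := 1) (v := g) (w := g * h)
  rwa [dist_eq_wordLength S hS g, inv_mul_cancel_left] at h1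

theorem wordLength_eq_zero_iff (hS : (SimpleGraph.mulCayley (S : Set G)).Connected) {g : G} :
    wordLength S g = 0 ↔ g = 1 := by
  unfold wordLength
  rw [hS.dist_eq_zero_iff, eq_comm]

theorem wordLength_le_one {s : G} (hs : s ∈ S) : wordLength S s ≤ 1 := by
  by_cases h : s = 1
  · simp [h]
  · have : (SimpleGraph.mulCayley (S : Set G)).Adj 1 s := by
      rw [SimpleGraph.mulCayley_adj]
      exact ⟨fun h' => h h'.symm, Or.inl (by simpa using hs)⟩
    exact (SimpleGraph.dist_eq_one_iff_adj.2 this).le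

theorem connected_mulCayley (hS_gen : Subgroup.closure (S : Set G) = ⊤) :
    (SimpleGraph.mulCayley (S : Set G)).Connected := by
  have key : ∀ g x : G, (SimpleGraph.mulCayley (S : Set G)).Reachable x (x * g) := by
    intro g
    have hg : g ∈ Subgroup.closure (S : Set G) := by rw [hS_gen]; trivial
    induction hg using Subgroup.closure_induction with
    | mem s hs =>
      intro x
      by_cases h : s = 1
      · simp [h]
      · apply SimpleGraph.Adj.reachable
        rw [SimpleGraph.mulCayley_adj]
        exact ⟨fun h' => h (by simpa using h'.symm), Or.inl (by simpa using hs)⟩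
    | one => intro x; simp
    | mul a b _ _ ha hb => intro x; rw [← mul_assoc]; exact (ha x).trans (hb _)
    | inv a _ ha => intro x; simpa using (ha (x * a⁻¹)).symm
  exact { preconnected := fun x y => by simpa using key (x⁻¹ * y) x }

theorem exists_mul_of_wordLength_eq_succ (hS_symm : ∀ s ∈ S, s⁻¹ ∈ S)
    (hS : (SimpleGraph.mulCayley (S : Set G)).Connected) {g : G} {n : ℕ}
    (h : wordLength S g = n + 1) : ∃ x, ∃ s ∈ S, wordLength S x = n ∧ g = x * s := by
  obtain ⟨p, hp⟩ := (hS g 1).exists_walk_length_eq_dist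
  rw [SimpleGraph.dist_comm] at hp
  cases p with
  | nil => simp [wordLength] at h
  | @cons _ z _ hadj q =>
    have hz : wordLength S z ≤ n := by
      have h1 := SimpleGraph.dist_le q
      rw [SimpleGraph.dist_comm] at h1
      have h2 : q.length + 1 = wordLength S g := hp
      unfold wordLength at *
      omega
    have hs : z⁻¹ * g ∈ S := by
      rcases ((SimpleGraph.mulCayley_adj _ _ _).1 hadj).2 with h' | h'
      · simpa using hS_symm _ h'
      · simpa using h'
    refine ⟨z, z⁻¹ * g, hs, ?_, by simp⟩
    have h3 := wordLength_mul_le S hS z (z⁻¹ * g)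
    have h4 := wordLength_le_one S hs
    rw [mul_inv_cancel_left] at h3
    omega

theorem finite_ball (hS_symm : ∀ s ∈ S, s⁻¹ ∈ S)
    (hS : (SimpleGraph.mulCayley (S : Set G)).Connected) (n : ℕ) : (ball S n).Finite := by
  induction n with
  | zero =>
    refine (Set.finite_singleton (1 : G)).subset fun g hg => ?_
    simpa [ball, wordLength_eq_zero_iff S hS] using hg
  | succ n ih =>
    refine (ih.union ((ih.mul S.finite_toSet))).subset fun g hg => ?_
    rcases Nat.lt_or_ge n (wordLength S g) with h | h
    · obtain ⟨x, s, hs, hx, rfl⟩ := exists_mul_of_wordLength_eq_succ S hS_symm hS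
        (le_antisymm hg h)
      exact Or.inr (Set.mul_mem_mul hx.le hs)
    · exact Or.inl h

end WordLength

/-! ### The lazy walk and its weighted $\ell^2$ bound -/

section Walk

variable {G : Type u} [Group G] (S : Finset G)

@[simp] theorem walk_zero : walk S 0 = 1 := by simp [walk]

theorem walk_succ (n : ℕ) : walk S (n + 1) = walk S n * lazyStep S := by
  simp [walk, pow_succ]

theorem sum_comp_inv {S : Finset G} (hS_symm : ∀ s ∈ S, s⁻¹ ∈ S) {M : Type*} [AddCommMonoid M]
    (f : G → M) : ∑ s ∈ S, f s⁻¹ = ∑ s ∈ S, f s :=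
  Finset.sum_nbij' (fun s => s⁻¹) (fun s => s⁻¹) hS_symm hS_symm (by simp) (by simp) (by simp)

theorem coeff_mul_lazyStep {S : Finset G} (hS_symm : ∀ s ∈ S, s⁻¹ ∈ S) (hS : S.Nonempty)
    (v : MonoidAlgebra ℝ G) (x : G) :
    (v * lazyStep S).coeff x =
      (S.card : ℝ)⁻¹ * ∑ s ∈ S, (v.coeff x + v.coeff (x * s)) / 2 := by
  have hc : (S.card : ℝ) ≠ 0 := by exact_mod_cast hS.card_pos.ne'
  have h1 : ∀ s : G, (v * MonoidAlgebra.single s 1).coeff x = v.coeff (x * s⁻¹) := fun s => by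
    rw [MonoidAlgebra.coeff_mul_single_eq_coeff_mul (m₂ := x * s⁻¹)]
    · simp
    · intro y _
      exact eq_mul_inv_iff_mul_eq.symm
  have h2 : ∑ s ∈ S, v.coeff (x * s⁻¹) = ∑ s ∈ S, v.coeff (x * s) :=
    sum_comp_inv hS_symm fun s => v.coeff (x * s)
  rw [lazyStep, mul_smul_comm, mul_add, mul_smul_comm, Finset.mul_sum]
  simp only [MonoidAlgebra.coeff_smul, MonoidAlgebra.coeff_add, MonoidAlgebra.coeff_sum,
    Finsupp.smul_apply, Finsupp.add_apply, Finsupp.finsetSum_apply, h1, h2, smul_eq_mul]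
  rw [inv_one, mul_one, ← Finset.sum_div, Finset.sum_add_distrib, Finset.sum_const, nsmul_eq_mul]
  field_simp

theorem walk_coeff_nonneg {S : Finset G} (hS_symm : ∀ s ∈ S, s⁻¹ ∈ S) (hS : S.Nonempty)
    (n : ℕ) (x : G) : 0 ≤ (walk S n).coeff x := by
  classical
  induction n generalizing x with
  | zero =>
    rw [walk_zero, MonoidAlgebra.one_def, MonoidAlgebra.coeff_single, Finsupp.single_apply]
    split_ifs <;> norm_num
  | succ n ih =>
    rw [walk_succ, coeff_mul_lazyStep hS_symm hS]
    exact mul_nonneg (by positivity) (Finset.sum_nonneg fun s _ => by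
      have := ih x
      have := ih (x * s)
      positivity)

/-- The augmentation of the group algebra. -/
noncomputable def augmentation (G : Type u) [Group G] : MonoidAlgebra ℝ G →ₐ[ℝ] ℝ :=
  MonoidAlgebra.lift ℝ ℝ G 1

@[simp] theorem augmentation_single (g : G) (r : ℝ) :
    augmentation G (MonoidAlgebra.single g r) = r := by
  simp [augmentation]

theorem augmentation_apply (v : MonoidAlgebra ℝ G) :
    augmentation G v = ∑ x ∈ v.coeff.support, v.coeff x := by
  simp [augmentation, MonoidAlgebra.lift_apply, Finsupp.sum]

theorem augmentation_lazyStep {S : Finset G} (hS : S.Nonempty) :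
    augmentation G (lazyStep S) = 1 := by
  have hc : (S.card : ℝ) ≠ 0 := by exact_mod_cast hS.card_pos.ne'
  simp only [lazyStep, map_smul, map_add, map_sum, augmentation_single, Finset.sum_const]
  simp only [smul_eq_mul, nsmul_eq_mul]
  field_simp
  norm_num

theorem sum_walk_coeff {S : Finset G} (hS : S.Nonempty) (n : ℕ) :
    ∑ x ∈ (walk S n).coeff.support, (walk S n).coeff x = 1 := by
  rw [← augmentation_apply, walk, map_pow, augmentation_lazyStep hS, one_pow]

/-- Cauchy–Schwarz over $S$ reduces to one generator at a time. Pairing $s$ with $s^{-1}$ and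
substituting $x\mapsto xs$ symmetrises the weight to $m(x)+m(xs)$, and a second Cauchy–Schwarz
brings in $m(x)^{-1}+m(xs)^{-1}$; `hc` bounds the product. -/
theorem tsum_sq_mul_lazyStep_le {S : Finset G} (hS_symm : ∀ s ∈ S, s⁻¹ ∈ S) (hS : S.Nonempty)
    (m : G → ℝ) (hm : ∀ x, 0 < m x) (c : ℝ)
    (hc : ∀ x, ∀ s ∈ S, (m x + m (x * s)) * ((m x)⁻¹ + (m (x * s))⁻¹) ≤ 4 * c)
    (v : MonoidAlgebra ℝ G) :
    ∑' x, m x * (v * lazyStep S).coeff x ^ 2 ≤ c * ∑' x, m x * v.coeff x ^ 2 := by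
  have hcard : (0 : ℝ) < S.card := by exact_mod_cast hS.card_pos
  set u : G → ℝ := ⇑v.coeff with hu
  have hfin : u.HasFiniteSupport := v.coeff.hasFiniteSupport
  have hfin' : ∀ s : G, (fun x => u (x * s)).HasFiniteSupport := fun s =>
    Set.Finite.preimage (mul_left_injective s).injOn hfin
  have hsum : ∀ (s : G) (f : G → ℝ), (∀ x, u x = 0 → u (x * s) = 0 → f x = 0) → Summable f := by
    intro s f hf
    refine summable_of_hasFiniteSupport (((hfin.union (hfin' s))).subset fun x hx => ?_)
    by_contra h
    simp only [Set.mem_union, Function.mem_support, not_or, not_not] at h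
    exact hx (hf x h.1 h.2)
  have hsu : Summable fun x => m x * u x ^ 2 := hsum 1 _ (by intro x h _; simp [h])
  set A : G → ℝ := fun s => ∑' x, m x * (u x + u (x * s)) ^ 2 with hA
  have hA_sum : ∀ s, Summable fun x => m x * (u x + u (x * s)) ^ 2 := fun s =>
    hsum s _ (by intro x h h'; simp [h, h'])
  have hA_inv : ∀ s, A s⁻¹ = ∑' x, m (x * s) * (u x + u (x * s)) ^ 2 := by
    intro s
    rw [hA]
    simp only
    rw [← (Equiv.mulRight s).tsum_eq]
    simp [add_comm]
  have hpair : ∀ s ∈ S, A s + A s⁻¹ ≤ 8 * c * ∑' x, m x * u x ^ 2 := by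
    intro s hs
    have h1 : ∑' x, m (x * s) * u (x * s) ^ 2 = ∑' x, m x * u x ^ 2 :=
      (Equiv.mulRight s).tsum_eq fun x => m x * u x ^ 2
    have h2 : Summable fun x => m (x * s) * u (x * s) ^ 2 := hsum s _ (by
      intro x _ h'; simp [h'])
    rw [hA_inv, hA]
    simp only
    rw [← (hA_sum s).tsum_add (hsum s _ (by intro x h h'; simp [h, h']))]
    calc _ ≤ ∑' x, 4 * c * (m x * u x ^ 2 + m (x * s) * u (x * s) ^ 2) := by
          refine Summable.tsum_le_tsum (fun x => ?_) (hsum s _ (by intro x h h'; simp [h, h']))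
            ((hsu.add h2).mul_left _)
          have hx := hm x
          have hy := hm (x * s)
          have hcs : (u x + u (x * s)) ^ 2 ≤ ((m x)⁻¹ + (m (x * s))⁻¹) *
              (m x * u x ^ 2 + m (x * s) * u (x * s) ^ 2) := by
            have : ((m x)⁻¹ + (m (x * s))⁻¹) * (m x * u x ^ 2 + m (x * s) * u (x * s) ^ 2) -
                (u x + u (x * s)) ^ 2 =
                (m x * u x - m (x * s) * u (x * s)) ^ 2 / (m x * m (x * s)) := by
              field_simp
              ring
            have h0 : 0 ≤ (m x * u x - m (x * s) * u (x * s)) ^ 2 / (m x * m (x * s)) := by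
              positivity
            linarith
          calc _ = (m x + m (x * s)) * (u x + u (x * s)) ^ 2 := by ring
            _ ≤ (m x + m (x * s)) * (((m x)⁻¹ + (m (x * s))⁻¹) *
              (m x * u x ^ 2 + m (x * s) * u (x * s) ^ 2)) := by gcongr
            _ = ((m x + m (x * s)) * ((m x)⁻¹ + (m (x * s))⁻¹)) *
              (m x * u x ^ 2 + m (x * s) * u (x * s) ^ 2) := by ring
            _ ≤ _ := mul_le_mul_of_nonneg_right (hc x s hs) (by positivity)
      _ = _ := by
          rw [tsum_mul_left, hsu.tsum_add h2, h1]
          ring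
  have hAS : ∑ s ∈ S, A s ≤ 4 * c * S.card * ∑' x, m x * u x ^ 2 := by
    have h1 := Finset.sum_le_sum hpair
    rw [Finset.sum_add_distrib, sum_comp_inv hS_symm, Finset.sum_const, nsmul_eq_mul] at h1
    linarith
  calc _ ≤ ∑' x, ∑ s ∈ S, (4 * (S.card : ℝ))⁻¹ * (m x * (u x + u (x * s)) ^ 2) := by
        have hS2 : Summable fun x => ∑ s ∈ S, (4 * (S.card : ℝ))⁻¹ *
            (m x * (u x + u (x * s)) ^ 2) :=
          summable_sum fun s _ => (hA_sum s).mul_left _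
        have hle : ∀ x, m x * (v * lazyStep S).coeff x ^ 2 ≤
            ∑ s ∈ S, (4 * (S.card : ℝ))⁻¹ * (m x * (u x + u (x * s)) ^ 2) := by
          intro x
          rw [coeff_mul_lazyStep hS_symm hS, ← Finset.mul_sum, ← Finset.mul_sum, mul_pow]
          have h1 : (∑ s ∈ S, (u x + u (x * s)) / 2) ^ 2 ≤
              S.card * ∑ s ∈ S, ((u x + u (x * s)) / 2) ^ 2 := sq_sum_le_card_mul_sum_sq
          have h2 : ∑ s ∈ S, ((u x + u (x * s)) / 2) ^ 2 =
              4⁻¹ * ∑ s ∈ S, (u x + u (x * s)) ^ 2 := by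
            rw [Finset.mul_sum]
            exact Finset.sum_congr rfl fun s _ => by ring
          rw [h2] at h1
          have hx := hm x
          calc _ ≤ m x * ((S.card : ℝ)⁻¹ ^ 2 *
                (S.card * (4⁻¹ * ∑ s ∈ S, (u x + u (x * s)) ^ 2))) := by gcongr
            _ = _ := by field_simp
        exact Summable.tsum_le_tsum hle
          (hS2.of_nonneg_of_le (fun x => mul_nonneg (hm x).le (sq_nonneg _)) hle) hS2
    _ = (4 * (S.card : ℝ))⁻¹ * ∑ s ∈ S, A s := by
        rw [Summable.tsum_finsetSum fun s _ => (hA_sum s).mul_left _, Finset.mul_sum]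
        exact Finset.sum_congr rfl fun s _ => tsum_mul_left
    _ ≤ (4 * (S.card : ℝ))⁻¹ * (4 * c * S.card * ∑' x, m x * u x ^ 2) := by gcongr
    _ = _ := by field_simp

theorem tsum_exp_mul_walk_sq_le {S : Finset G} (hS_symm : ∀ s ∈ S, s⁻¹ ∈ S) (hS : S.Nonempty)
    (hconn : (SimpleGraph.mulCayley (S : Set G)).Connected) (a : ℝ) (n : ℕ) :
    ∑' x, Real.exp (2 * a * wordLength S x) * (walk S n).coeff x ^ 2 ≤ Real.exp (a ^ 2 * n) := by
  classical
  induction n with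
  | zero =>
    rw [tsum_eq_single 1]
    · simp [MonoidAlgebra.one_def]
    · intro x hx
      simp [MonoidAlgebra.one_def, hx.symm]
  | succ n ih =>
    rw [walk_succ]
    have hcosh : Real.cosh a ^ 2 ≤ Real.exp (a ^ 2) := by
      have := pow_le_pow_left₀ (Real.cosh_pos a).le (Real.cosh_le_exp_half_sq a) 2
      rwa [← Real.exp_nat_mul, Nat.cast_ofNat, mul_div_cancel₀ _ two_ne_zero] at this
    calc _ ≤ Real.cosh a ^ 2 *
          ∑' x, Real.exp (2 * a * wordLength S x) * (walk S n).coeff x ^ 2 := by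
          refine tsum_sq_mul_lazyStep_le hS_symm hS _ (fun x => Real.exp_pos _) _ ?_ _
          intro x s hs
          set p : ℝ := (wordLength S x : ℝ)
          set q : ℝ := (wordLength S (x * s) : ℝ)
          have hd : |q - p| ≤ 1 := by
            have h1 := wordLength_mul_le S hconn x s
            have h2 := wordLength_mul_le S hconn (x * s) s⁻¹
            have h3 := wordLength_le_one S hs
            have h4 := wordLength_le_one S (hS_symm s hs)
            rw [mul_inv_cancel_right] at h2
            rw [abs_le]
            constructor
            · have : (wordLength S x : ℝ) ≤ wordLength S (x * s) + 1 := by exact_mod_cast by omega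
              linarith
            · have : (wordLength S (x * s) : ℝ) ≤ wordLength S x + 1 := by exact_mod_cast by omega
              linarith
          -- The product depends only on the change $q-p$ of length, which is at most one in
          -- absolute value.
          have h1 : (Real.exp (2 * a * p) + Real.exp (2 * a * q)) *
              ((Real.exp (2 * a * p))⁻¹ + (Real.exp (2 * a * q))⁻¹) =
              4 * Real.cosh (a * (q - p)) ^ 2 := by
            rw [Real.cosh_eq, ← Real.exp_neg, ← Real.exp_neg]
            have e1 : Real.exp (2 * a * p) * Real.exp (-(2 * a * p)) = 1 := by
              rw [← Real.exp_add]; simp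
            have e2 : Real.exp (2 * a * q) * Real.exp (-(2 * a * q)) = 1 := by
              rw [← Real.exp_add]; simp
            have e3 : Real.exp (2 * a * p) * Real.exp (-(2 * a * q)) =
                Real.exp (-(a * (q - p))) ^ 2 := by
              rw [← Real.exp_add, ← Real.exp_nat_mul]; congr 1; push_cast; ring
            have e4 : Real.exp (2 * a * q) * Real.exp (-(2 * a * p)) =
                Real.exp (a * (q - p)) ^ 2 := by
              rw [← Real.exp_add, ← Real.exp_nat_mul]; congr 1; push_cast; ring
            have e5 : Real.exp (a * (q - p)) * Real.exp (-(a * (q - p))) = 1 := by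
              rw [← Real.exp_add]; simp
            linear_combination e1 + e2 + e3 + e4 - 2 * e5
          rw [h1]
          gcongr
          rw [Real.cosh_le_cosh, abs_mul]
          exact mul_le_of_le_one_right (abs_nonneg a) hd
      _ ≤ Real.exp (a ^ 2) * Real.exp (a ^ 2 * n) := by gcongr
      _ = _ := by rw [← Real.exp_add]; congr 1; push_cast; ring

end Walk

/-! ### Two inequalities between drift and entropy -/

section Entropy

variable {G : Type u} [Group G] {S : Finset G}

/-- Jensen's inequality for $\ln$ applied to $e^{2a|x|}P^{(n)}(x)$ under $P^{(n)}$ itself, in the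
form $\ln t\le t-1$ after normalising by $T=e^{a^2n}$. -/
theorem two_mul_speed_le (hS_symm : ∀ s ∈ S, s⁻¹ ∈ S) (hS : S.Nonempty)
    (hconn : (SimpleGraph.mulCayley (S : Set G)).Connected) (a : ℝ) (n : ℕ) :
    2 * a * speed S n ≤ a ^ 2 * n + entropy S n := by
  set F := (walk S n).coeff.support with hF
  set u : G → ℝ := ⇑(walk S n).coeff with hu
  have hsum : ∑ x ∈ F, u x = 1 := sum_walk_coeff hS n
  have hpos : ∀ x ∈ F, 0 < u x := fun x hx =>
    lt_of_le_of_ne (walk_coeff_nonneg hS_symm hS n x) (Finsupp.mem_support_iff.1 hx).symm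
  set T := Real.exp (a ^ 2 * n) with hT
  have hT0 : 0 < T := Real.exp_pos _
  have hw : ∑ x ∈ F, Real.exp (2 * a * wordLength S x) * u x ^ 2 ≤ T := by
    refine le_trans (Summable.sum_le_tsum F (fun x _ => by positivity) ?_)
      (tsum_exp_mul_walk_sq_le hS_symm hS hconn a n)
    refine summable_of_hasFiniteSupport ((walk S n).coeff.hasFiniteSupport.subset fun x hx => ?_)
    intro h
    apply hx
    simp [hu, h]
  have key : ∀ x ∈ F, u x * (2 * a * wordLength S x) + u x * Real.log (u x) ≤
      (Real.exp (2 * a * wordLength S x) * u x ^ 2) / T - u x + u x * (a ^ 2 * n) := by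
    intro x hx
    have hux := hpos x hx
    have h1 := Real.log_le_sub_one_of_pos
      (show 0 < Real.exp (2 * a * wordLength S x) * u x / T by positivity)
    rw [Real.log_div (by positivity) hT0.ne', Real.log_mul (by positivity) hux.ne',
      Real.log_exp, hT, Real.log_exp, ← hT] at h1
    have h2 := mul_le_mul_of_nonneg_left h1 hux.le
    calc _ = u x * (2 * a * wordLength S x + Real.log (u x) - a ^ 2 * n) + u x * (a ^ 2 * n) := by
          ring
      _ ≤ _ := by
          refine (add_le_add_left h2 _).trans_eq ?_
          ring
  have h3 := Finset.sum_le_sum key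
  simp only [Finset.sum_add_distrib, Finset.sum_sub_distrib, ← Finset.sum_mul,
    ← Finset.sum_div, hsum] at h3
  have h4 : (∑ x ∈ F, Real.exp (2 * a * wordLength S x) * u x ^ 2) / T ≤ 1 :=
    (div_le_one hT0).2 hw
  have h5 : ∑ x ∈ F, u x * (2 * a * wordLength S x) = 2 * a * speed S n := by
    rw [speed, Finset.mul_sum]
    exact Finset.sum_congr rfl fun x _ => by ring
  have h6 : ∑ x ∈ F, u x * Real.log (u x) = -entropy S n := by
    rw [entropy, neg_neg]
  rw [h5, h6] at h3
  linarith

/-- Gibbs' variational principle: relative entropy with respect to the measure $e^{-a|x|}/Z$ on the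
support is nonnegative. -/
theorem entropy_le_add_log (hS_symm : ∀ s ∈ S, s⁻¹ ∈ S) (hS : S.Nonempty) (a : ℝ) (n : ℕ) :
    entropy S n ≤ a * speed S n +
      Real.log (∑ x ∈ (walk S n).coeff.support, Real.exp (-(a * wordLength S x))) := by
  set F := (walk S n).coeff.support with hF
  set u : G → ℝ := ⇑(walk S n).coeff with hu
  have hsum : ∑ x ∈ F, u x = 1 := sum_walk_coeff hS n
  have hpos : ∀ x ∈ F, 0 < u x := fun x hx =>
    lt_of_le_of_ne (walk_coeff_nonneg hS_symm hS n x) (Finsupp.mem_support_iff.1 hx).symm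
  have hne : F.Nonempty := by
    by_contra h
    rw [Finset.not_nonempty_iff_eq_empty.1 h] at hsum
    simp at hsum
  set Z := ∑ x ∈ F, Real.exp (-(a * wordLength S x)) with hZ
  have hZ0 : 0 < Z := Finset.sum_pos (fun x _ => Real.exp_pos _) hne
  have key : ∀ x ∈ F, -(u x * Real.log (u x)) - a * (u x * wordLength S x) - u x * Real.log Z ≤
      Real.exp (-(a * wordLength S x)) / Z - u x := by
    intro x hx
    have hux := hpos x hx
    have h1 := Real.log_le_sub_one_of_pos
      (show 0 < Real.exp (-(a * wordLength S x)) / (Z * u x) by positivity)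
    rw [Real.log_div (by positivity) (by positivity), Real.log_mul hZ0.ne' hux.ne',
      Real.log_exp] at h1
    have h2 := mul_le_mul_of_nonneg_left h1 hux.le
    calc _ = u x * (-(a * wordLength S x) - (Real.log Z + Real.log (u x))) := by ring
      _ ≤ _ := h2
      _ = _ := by field_simp
  have h3 := Finset.sum_le_sum key
  simp only [Finset.sum_sub_distrib, ← Finset.sum_mul, ← Finset.mul_sum, ← Finset.sum_div,
    Finset.sum_neg_distrib, hsum, ← hZ, div_self hZ0.ne'] at h3
  have h5 : ∑ x ∈ F, u x * (wordLength S x : ℝ) = speed S n := rfl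
  have h6 : -∑ x ∈ F, u x * Real.log (u x) = entropy S n := rfl
  rw [h5, h6] at h3
  linarith

/-- Since $\nu\le1$, the growth exponent satisfies $Kr^\nu\le KR^\nu+\delta r$ with
$\delta=KR^{\nu-1}$. The decay rate is $2\delta$, so half of it cancels the growth of spheres and
the other half leaves a geometric series. -/
theorem sum_exp_neg_wordLength_le (hS_symm : ∀ s ∈ S, s⁻¹ ∈ S)
    (hconn : (SimpleGraph.mulCayley (S : Set G)).Connected)
    {K L ν : ℝ} (hK : 0 < K) (hL : 0 < L) (hν_le : ν ≤ 1) (hν_pos : 0 < ν)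
    (hgrowth : ∀ n : ℕ, ((ball S n).ncard : ℝ) ≤ L * Real.exp (K * (n : ℝ) ^ ν))
    {R : ℝ} (hR : 1 ≤ R) (F : Finset G) :
    ∑ x ∈ F, Real.exp (-(2 * K * R ^ (ν - 1) * wordLength S x)) ≤
      L * Real.exp (K * R ^ ν) * (1 + (K * R ^ (ν - 1))⁻¹) := by
  classical
  have hR0 : 0 < R := by linarith
  set δ := K * R ^ (ν - 1) with hδ
  have hδ0 : 0 < δ := by positivity
  have hpow : ∀ r : ℕ, K * (r : ℝ) ^ ν ≤ K * R ^ ν + δ * r := by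
    intro r
    have hRν : 0 < R ^ ν := by positivity
    rcases le_total (r : ℝ) R with h | h
    · have : (r : ℝ) ^ ν ≤ R ^ ν := Real.rpow_le_rpow (by positivity) h hν_pos.le
      have : 0 ≤ δ * r := by positivity
      nlinarith
    · have hr : (0 : ℝ) < r := by linarith
      have h1 : (r : ℝ) ^ (ν - 1) ≤ R ^ (ν - 1) :=
        Real.rpow_le_rpow_of_nonpos hR0 h (by linarith)
      have h2 : (r : ℝ) ^ ν = (r : ℝ) ^ (ν - 1) * r := by
        rw [Real.rpow_sub_one hr.ne']; field_simp
      calc K * (r : ℝ) ^ ν = K * (r : ℝ) ^ (ν - 1) * r := by rw [h2]; ring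
        _ ≤ K * R ^ (ν - 1) * r := by gcongr
        _ ≤ _ := by rw [hδ]; nlinarith
  obtain ⟨N, hN⟩ : ∃ N : ℕ, ∀ x ∈ F, wordLength S x ∈ Finset.range N :=
    ⟨F.sup (wordLength S) + 1, fun x hx =>
      Finset.mem_range.2 (Nat.lt_succ_of_le (Finset.le_sup (f := wordLength S) hx))⟩
  have hgeom : ∑ r ∈ Finset.range N, Real.exp (-δ) ^ r ≤ 1 + δ⁻¹ := by
    have he : Real.exp (-δ) < 1 := by simpa using hδ0
    have h1 := Summable.sum_le_tsum (Finset.range N) (fun r _ => by positivity)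
      (summable_geometric_of_lt_one (Real.exp_pos (-δ)).le he)
    rw [tsum_geometric_of_lt_one (Real.exp_pos (-δ)).le he] at h1
    refine h1.trans ?_
    have h2 : δ / (1 + δ) ≤ 1 - Real.exp (-δ) := by
      have h3 : Real.exp (-δ) ≤ (1 + δ)⁻¹ := by
        rw [Real.exp_neg]
        apply inv_anti₀ (by linarith)
        linarith [Real.add_one_le_exp δ]
      have h4 : δ / (1 + δ) = 1 - (1 + δ)⁻¹ := by field_simp; ring
      linarith
    calc (1 - Real.exp (-δ))⁻¹ ≤ (δ / (1 + δ))⁻¹ := inv_anti₀ (by positivity) h2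
      _ = 1 + δ⁻¹ := by field_simp; ring
  calc ∑ x ∈ F, Real.exp (-(2 * K * R ^ (ν - 1) * wordLength S x))
      = ∑ r ∈ Finset.range N, ∑ x ∈ F with wordLength S x = r,
          Real.exp (-(2 * K * R ^ (ν - 1) * wordLength S x)) :=
        (Finset.sum_fiberwise_of_maps_to hN _).symm
    _ ≤ ∑ r ∈ Finset.range N, L * Real.exp (K * R ^ ν) * Real.exp (-δ) ^ r := by
        refine Finset.sum_le_sum fun r _ => ?_
        have hcard : ((F.filter fun x => wordLength S x = r).card : ℝ) ≤
            L * Real.exp (K * (r : ℝ) ^ ν) := by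
          refine le_trans ?_ (hgrowth r)
          have hsub : ((F.filter fun x => wordLength S x = r : Finset G) : Set G) ⊆ ball S r :=
            fun x hx => (Finset.mem_filter.1 (Finset.mem_coe.1 hx)).2.le
          have hle := Set.ncard_le_ncard hsub (finite_ball S hS_symm hconn r)
          rw [Set.ncard_coe_finset] at hle
          exact_mod_cast hle
        calc _ = ∑ x ∈ F with wordLength S x = r, Real.exp (-(2 * δ * r)) := by
              refine Finset.sum_congr rfl fun x hx => ?_
              rw [(Finset.mem_filter.1 hx).2, hδ]
              ring_nf
          _ = ((F.filter fun x => wordLength S x = r).card : ℝ) * Real.exp (-(2 * δ * r)) := by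
              rw [Finset.sum_const, nsmul_eq_mul]
          _ ≤ L * Real.exp (K * R ^ ν + δ * r) * Real.exp (-(2 * δ * r)) := by
              gcongr
              exact hcard.trans (by gcongr; exact hpow r)
          _ = _ := by
              have e : K * R ^ ν + δ * r + -(2 * δ * r) = K * R ^ ν + r * -δ := by ring
              rw [mul_assoc, ← Real.exp_add, e, Real.exp_add, ← mul_assoc, Real.exp_nat_mul]
    _ ≤ _ := by
        rw [← Finset.mul_sum]
        gcongr

theorem exists_entropy_le (hS_symm : ∀ s ∈ S, s⁻¹ ∈ S) (hS : S.Nonempty)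
    (hconn : (SimpleGraph.mulCayley (S : Set G)).Connected)
    {K L ν : ℝ} (hK : 0 < K) (hL : 0 < L) (hν_pos : 0 < ν) (hν_le : ν ≤ 1)
    (hgrowth : ∀ n : ℕ, ((ball S n).ncard : ℝ) ≤ L * Real.exp (K * (n : ℝ) ^ ν)) :
    ∃ C : ℝ, 0 < C ∧ ∀ (n : ℕ) (R : ℝ), 1 ≤ R →
      entropy S n ≤ 2 * K * R ^ (ν - 1) * speed S n + C * R ^ ν := by
  refine ⟨|Real.log L| + K + (|Real.log (1 + K⁻¹)| + 1 / ν), by positivity, fun n R hR => ?_⟩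
  have hR0 : 0 < R := by linarith
  have hRν : 1 ≤ R ^ ν := Real.one_le_rpow hR hν_pos.le
  refine (entropy_le_add_log hS_symm hS (2 * K * R ^ (ν - 1)) n).trans ?_
  have hne : (walk S n).coeff.support.Nonempty := by
    by_contra h
    have := sum_walk_coeff hS n
    rw [Finset.not_nonempty_iff_eq_empty.1 h] at this
    simp at this
  have h1 := Real.log_le_log (Finset.sum_pos (fun x _ => Real.exp_pos _) hne)
    (sum_exp_neg_wordLength_le hS_symm hconn hK hL hν_le hν_pos hgrowth hR
      (walk S n).coeff.support)
  rw [Real.log_mul (by positivity) (by positivity), Real.log_mul hL.ne' (by positivity),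
    Real.log_exp] at h1
  -- The geometric-series factor is at most linear in $R$, so its logarithm is absorbed by $R^\nu$
  -- through $\ln R\le R^\nu/\nu$.
  have h2 : 1 + (K * R ^ (ν - 1))⁻¹ ≤ (1 + K⁻¹) * R := by
    have h3 : (R ^ (ν - 1))⁻¹ ≤ R := by
      rw [← Real.rpow_neg hR0.le]
      calc R ^ (-(ν - 1)) ≤ R ^ (1 : ℝ) := Real.rpow_le_rpow_of_exponent_le hR (by linarith)
        _ = R := Real.rpow_one R
    rw [mul_inv]
    have : K⁻¹ * (R ^ (ν - 1))⁻¹ ≤ K⁻¹ * R := by gcongr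
    linarith
  have h4 : Real.log (1 + (K * R ^ (ν - 1))⁻¹) ≤ Real.log (1 + K⁻¹) + R ^ ν / ν := by
    refine (Real.log_le_log (by positivity) h2).trans ?_
    rw [Real.log_mul (by positivity) hR0.ne']
    linarith [Real.log_le_rpow_div hR0.le hν_pos]
  have h5 : Real.log L ≤ |Real.log L| * R ^ ν :=
    (le_abs_self _).trans (le_mul_of_one_le_right (abs_nonneg _) hRν)
  have h6 : Real.log (1 + K⁻¹) ≤ |Real.log (1 + K⁻¹)| * R ^ ν :=
    (le_abs_self _).trans (le_mul_of_one_le_right (abs_nonneg _) hRν)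
  have h7 : R ^ ν / ν = 1 / ν * R ^ ν := by ring
  linarith

end Entropy

/-! ### Comparison of powers of $n$ -/

section PowerBounds

theorem le_of_forall_mul_rpow_le {A B c d : ℝ} (hA : 0 < A)
    (h : ∀ n : ℕ, 1 ≤ n → A * (n : ℝ) ^ c ≤ B * (n : ℝ) ^ d) : c ≤ d := by
  by_contra! hcd
  have ht : Filter.Tendsto (fun n : ℕ => (n : ℝ) ^ (c - d)) Filter.atTop Filter.atTop :=
    (tendsto_rpow_atTop (sub_pos.2 hcd)).comp tendsto_natCast_atTop_atTop
  obtain ⟨n, hn1, hn⟩ := ((Filter.eventually_ge_atTop 1).and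
    (ht.eventually_gt_atTop (B / A))).exists
  have hn0 : (0 : ℝ) < n := by exact_mod_cast hn1
  have h1 := h n hn1
  rw [Real.rpow_sub hn0, div_lt_div_iff₀ hA (by positivity)] at hn
  linarith

theorem exists_mul_le_of_eventually {f g : ℕ → ℝ} (hf : ∀ n, 1 ≤ n → 0 < f n)
    (hg : ∀ n, 1 ≤ n → 0 < g n) {A : ℝ} (hA : 0 < A)
    (h : ∀ᶠ n in Filter.atTop, A * g n ≤ f n) :
    ∃ c, 0 < c ∧ ∀ n, 1 ≤ n → c * g n ≤ f n := by
  obtain ⟨N, hN⟩ := Filter.eventually_atTop.1 h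
  have key : ∀ M : ℕ, ∃ c, 0 < c ∧ ∀ n, 1 ≤ n → n < M → c * g n ≤ f n := by
    intro M
    induction M with
    | zero => exact ⟨1, one_pos, fun n _ hn => absurd hn (Nat.not_lt_zero n)⟩
    | succ M ih =>
      obtain ⟨c, hc, hcM⟩ := ih
      by_cases hM : 1 ≤ M
      · refine ⟨min c (f M / g M), lt_min hc (div_pos (hf M hM) (hg M hM)), fun n hn hnM => ?_⟩
        rcases Nat.lt_succ_iff_lt_or_eq.1 hnM with h' | rfl
        · exact (mul_le_mul_of_nonneg_right (min_le_left _ _) (hg n hn).le).trans (hcM n hn h')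
        · exact (le_div_iff₀ (hg n hn)).1 (min_le_right _ _)
      · exact ⟨c, hc, fun n hn hnM => by omega⟩
  obtain ⟨c, hc, hcN⟩ := key N
  refine ⟨min c A, lt_min hc hA, fun n hn => ?_⟩
  rcases lt_or_ge n N with h' | h'
  · exact (mul_le_mul_of_nonneg_right (min_le_left _ _) (hg n hn).le).trans (hcN n hn h')
  · exact (mul_le_mul_of_nonneg_right (min_le_right _ _) (hg n hn).le).trans (hN n h')

end PowerBounds

/-! ### Upper bounds for drift and entropy; drift from entropy -/

section SpeedAndEntropy

variable {G : Type u} [Group G] {S : Finset G}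

theorem speed_nonneg (hS_symm : ∀ s ∈ S, s⁻¹ ∈ S) (hS : S.Nonempty) (n : ℕ) : 0 ≤ speed S n :=
  Finset.sum_nonneg fun x _ => mul_nonneg (walk_coeff_nonneg hS_symm hS n x) (Nat.cast_nonneg _)

@[simp] theorem speed_zero : speed S 0 = 0 := by
  rw [speed]
  refine Finset.sum_eq_zero fun x hx => ?_
  have : x = 1 := by
    by_contra h
    rw [walk_zero, Finsupp.mem_support_iff, MonoidAlgebra.one_def, MonoidAlgebra.coeff_single] at hx
    exact hx (Finsupp.single_eq_of_ne h)
  simp [this]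

theorem entropy_eq_zero_of_speed_eq_zero (hS_symm : ∀ s ∈ S, s⁻¹ ∈ S) (hS : S.Nonempty)
    (hconn : (SimpleGraph.mulCayley (S : Set G)).Connected) {n : ℕ} (h : speed S n = 0) :
    entropy S n = 0 := by
  rw [speed, Finset.sum_eq_zero_iff_of_nonneg fun x _ =>
    mul_nonneg (walk_coeff_nonneg hS_symm hS n x) (Nat.cast_nonneg _)] at h
  have hone : ∀ x ∈ (walk S n).coeff.support, x = 1 := by
    intro x hx
    rcases mul_eq_zero.1 (h x hx) with h' | h'
    · exact absurd h' (Finsupp.mem_support_iff.1 hx)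
    · exact (wordLength_eq_zero_iff S hconn).1 (by exact_mod_cast h')
  have hsum := sum_walk_coeff hS n
  have hne : (walk S n).coeff.support.Nonempty := by
    by_contra h
    rw [Finset.not_nonempty_iff_eq_empty.1 h] at hsum
    simp at hsum
  have hsupp : (walk S n).coeff.support = {1} :=
    Finset.eq_singleton_iff_nonempty_unique_mem.2 ⟨hne, hone⟩
  rw [hsupp, Finset.sum_singleton] at hsum
  rw [entropy, hsupp, Finset.sum_singleton, hsum]
  simp

theorem exists_speed_le_and_entropy_le (hS_symm : ∀ s ∈ S, s⁻¹ ∈ S) (hS : S.Nonempty)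
    (hconn : (SimpleGraph.mulCayley (S : Set G)).Connected)
    {K L ν : ℝ} (hK : 0 < K) (hL : 0 < L) (hν_pos : 0 < ν) (hν_le : ν ≤ 1)
    (hgrowth : ∀ n : ℕ, ((ball S n).ncard : ℝ) ≤ L * Real.exp (K * (n : ℝ) ^ ν)) :
    ∃ C : ℝ, 0 < C ∧ (∀ n : ℕ, speed S n ≤ C * (n : ℝ) ^ (1 / (2 - ν))) ∧
      ∀ n : ℕ, 1 ≤ n → entropy S n ≤ C * (n : ℝ) ^ (ν / (2 - ν)) := by
  obtain ⟨C, hC, hH⟩ := exists_entropy_le hS_symm hS hconn hK hL hν_pos hν_le hgrowth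
  have h2ν : 0 < 2 - ν := by linarith
  have key : ∀ n : ℕ, 1 ≤ n → speed S n ≤ (2 * K + C / (2 * K)) * (n : ℝ) ^ (1 / (2 - ν)) ∧
      entropy S n ≤ (4 * K ^ 2 + 2 * C) * (n : ℝ) ^ (ν / (2 - ν)) := by
    intro n hn
    have hn1 : (1 : ℝ) ≤ n := by exact_mod_cast hn
    have hn0 : (0 : ℝ) < n := by linarith
    set R : ℝ := (n : ℝ) ^ (1 / (2 - ν)) with hR
    have hR1 : 1 ≤ R := Real.one_le_rpow hn1 (by positivity)
    have hR0 : 0 < R := by linarith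
    have hRν : R ^ ν = (n : ℝ) ^ (ν / (2 - ν)) := by
      rw [hR, ← Real.rpow_mul hn0.le]; congr 1; field_simp
    have hnR : (n : ℝ) = R ^ (2 - ν) := by
      rw [hR, ← Real.rpow_mul hn0.le, one_div_mul_cancel h2ν.ne', Real.rpow_one]
    set r := R ^ (ν - 1) with hr
    have hr0 : 0 < r := by positivity
    have hrR : r * R = R ^ ν := by
      rw [hr, Real.rpow_sub_one hR0.ne']; field_simp
    have hrn : r * n = R := by
      rw [hnR, hr, ← Real.rpow_add hR0]; ring_nf; exact Real.rpow_one R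
    -- This $a$ gives the drift the coefficient $4Kr$, while the entropy bound returns only $2Kr$ of
    -- it. The error terms $r^2n$ and $R^\nu$ both equal $rR$.
    have h1 := two_mul_speed_le hS_symm hS hconn (2 * K * r) n
    have h2 := hH n R hR1
    rw [← hr, ← hrR] at h2
    have h3 : speed S n ≤ (2 * K + C / (2 * K)) * R := by
      have h4 : 2 * K * r * speed S n ≤ 2 * K * r * ((2 * K + C / (2 * K)) * R) := by
        calc 2 * K * r * speed S n ≤ (2 * K * r) ^ 2 * n + C * (r * R) := by linarith
          _ = 2 * K * r * (2 * K * (r * n)) + C * (r * R) := by ring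
          _ = _ := by rw [hrn]; field_simp
      exact le_of_mul_le_mul_left h4 (by positivity)
    refine ⟨h3, ?_⟩
    rw [← hRν, ← hrR]
    calc entropy S n ≤ 2 * K * r * speed S n + C * (r * R) := h2
      _ ≤ 2 * K * r * ((2 * K + C / (2 * K)) * R) + C * (r * R) := by gcongr
      _ = _ := by field_simp; ring
  refine ⟨(2 * K + C / (2 * K)) + (4 * K ^ 2 + 2 * C), by positivity, fun n => ?_, fun n hn => ?_⟩
  · rcases Nat.eq_zero_or_pos n with rfl | hn
    · rw [speed_zero]
      positivity
    · refine (key n hn).1.trans ?_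
      have : 0 < 4 * K ^ 2 + 2 * C := by positivity
      exact mul_le_mul_of_nonneg_right (by linarith) (by positivity)
  · refine (key n hn).2.trans ?_
    have : 0 < 2 * K + C / (2 * K) := by positivity
    exact mul_le_mul_of_nonneg_right (by linarith) (by positivity)

theorem exists_le_speed (hS_symm : ∀ s ∈ S, s⁻¹ ∈ S) (hS : S.Nonempty)
    (hconn : (SimpleGraph.mulCayley (S : Set G)).Connected)
    {K L ν : ℝ} (hK : 0 < K) (hL : 0 < L) (hν_pos : 0 < ν) (hν_le : ν ≤ 1)
    (hgrowth : ∀ n : ℕ, ((ball S n).ncard : ℝ) ≤ L * Real.exp (K * (n : ℝ) ^ ν))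
    {h L' : ℝ} (hh : 0 < h) (hL' : 0 < L')
    (hent : ∀ n : ℕ, 1 ≤ n → L' * (n : ℝ) ^ h ≤ entropy S n) :
    ∃ c : ℝ, 0 < c ∧ ∀ n : ℕ, 1 ≤ n → c * (n : ℝ) ^ (h / ν) ≤ speed S n := by
  obtain ⟨C, hC, hH⟩ := exists_entropy_le hS_symm hS hconn hK hL hν_pos hν_le hgrowth
  set A := L' / (2 * K + C) with hA
  have hA0 : 0 < A := by positivity
  have hmax : ∀ n : ℕ, 1 ≤ n → A ^ (1 / ν) * (n : ℝ) ^ (h / ν) ≤ max 1 (speed S n) := by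
    intro n hn
    -- The drift itself is the radius that makes both terms of the entropy bound at most a multiple
    -- of $R^\nu$; the maximum ensures $R\ge1$ and is discarded for large $n$.
    set R := max 1 (speed S n) with hR
    have hR1 : 1 ≤ R := le_max_left _ _
    have hR0 : 0 < R := by linarith
    have h1 : R ^ (ν - 1) * speed S n ≤ R ^ ν := by
      calc R ^ (ν - 1) * speed S n ≤ R ^ (ν - 1) * R := by gcongr; exact le_max_right _ _
        _ = R ^ ν := by rw [Real.rpow_sub_one hR0.ne']; field_simp
    have h2 : A * (n : ℝ) ^ h ≤ R ^ ν := by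
      rw [hA, div_mul_eq_mul_div, div_le_iff₀ (by positivity)]
      calc L' * (n : ℝ) ^ h ≤ 2 * K * R ^ (ν - 1) * speed S n + C * R ^ ν :=
            (hent n hn).trans (hH n R hR1)
        _ = 2 * K * (R ^ (ν - 1) * speed S n) + C * R ^ ν := by ring
        _ ≤ 2 * K * R ^ ν + C * R ^ ν := by gcongr
        _ = _ := by ring
    have h3 := Real.rpow_le_rpow (by positivity) h2 (z := 1 / ν) (by positivity)
    rw [Real.mul_rpow hA0.le (by positivity), ← Real.rpow_mul (Nat.cast_nonneg n),
      ← Real.rpow_mul hR0.le, mul_one_div, mul_one_div, div_self hν_pos.ne', Real.rpow_one] at h3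
    exact h3
  have hA' : 0 < A ^ (1 / ν) := by positivity
  refine exists_mul_le_of_eventually (fun n hn => ?_)
    (fun n hn => Real.rpow_pos_of_pos (by exact_mod_cast hn) _) hA' ?_
  -- Positivity is needed to treat the finitely many small $n$: zero drift would mean zero entropy,
  -- against `hent`.
  · refine lt_of_le_of_ne (speed_nonneg hS_symm hS n) fun h0 => ?_
    have h1 := hent n hn
    rw [entropy_eq_zero_of_speed_eq_zero hS_symm hS hconn h0.symm] at h1
    have hn0 : (0 : ℝ) < n := by exact_mod_cast hn
    have : 0 < L' * (n : ℝ) ^ h := by positivity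
    linarith
  · have ht : Filter.Tendsto (fun n : ℕ => (n : ℝ) ^ (h / ν)) Filter.atTop Filter.atTop :=
      (tendsto_rpow_atTop (by positivity)).comp tendsto_natCast_atTop_atTop
    filter_upwards [Filter.eventually_ge_atTop 1,
      (ht.const_mul_atTop hA').eventually_gt_atTop 1] with n hn hn'
    exact (le_max_iff.1 (hmax n hn)).resolve_left (not_le.2 hn')

end SpeedAndEntropy

/-! ### Kernels of negative type along the walk -/

section NegativeType

variable {G : Type u}

/-- The linear extension of `φ : G → E` to the group algebra. -/
noncomputable def linearExtension {E : Type*} [AddCommGroup E] [Module ℝ E] (φ : G → E) :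
    MonoidAlgebra ℝ G →ₗ[ℝ] E :=
  Finsupp.linearCombination ℝ φ ∘ₗ (MonoidAlgebra.coeffLinearEquiv ℝ).toLinearMap

@[simp] theorem linearExtension_single {E : Type*} [AddCommGroup E] [Module ℝ E] (φ : G → E)
    (g : G) (r : ℝ) : linearExtension φ (MonoidAlgebra.single g r) = r • φ g := by
  simp [linearExtension]

variable [Group G]

/-- The linear extension of `g ↦ g⁻¹` to the group algebra. -/
noncomputable def inversion : MonoidAlgebra ℝ G →ₗ[ℝ] MonoidAlgebra ℝ G :=
  linearExtension fun g => MonoidAlgebra.single g⁻¹ 1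

@[simp] theorem inversion_single (g : G) (r : ℝ) :
    inversion (MonoidAlgebra.single g r) = MonoidAlgebra.single g⁻¹ r := by
  simp [inversion]

@[simp] theorem inversion_one : inversion (1 : MonoidAlgebra ℝ G) = 1 := by
  simp [MonoidAlgebra.one_def]

theorem inversion_mul (v w : MonoidAlgebra ℝ G) :
    inversion (v * w) = inversion w * inversion v := by
  induction v using MonoidAlgebra.induction_linear with
  | zero => simp
  | add v v' hv hv' => simp [add_mul, mul_add, hv, hv']
  | single g r =>
    induction w using MonoidAlgebra.induction_linear with
    | zero => simp
    | add w w' hw hw' => simp [add_mul, mul_add, hw, hw']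
    | single g' r' => simp [mul_comm]

theorem inversion_lazyStep {S : Finset G} (hS_symm : ∀ s ∈ S, s⁻¹ ∈ S) :
    inversion (lazyStep S) = lazyStep S := by
  simp only [lazyStep, map_smul, map_add, map_sum, inversion_single, inv_one]
  rw [sum_comp_inv hS_symm fun s => MonoidAlgebra.single s (1 : ℝ)]

theorem inversion_walk {S : Finset G} (hS_symm : ∀ s ∈ S, s⁻¹ ∈ S) (n : ℕ) :
    inversion (walk S n) = walk S n := by
  induction n with
  | zero => simp
  | succ n ih =>
    rw [walk_succ, inversion_mul, ih, inversion_lazyStep hS_symm, walk, ← pow_succ', ← pow_succ]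

theorem lazyStep_eq_sum {S : Finset G} (hS_symm : ∀ s ∈ S, s⁻¹ ∈ S) (hS : S.Nonempty) :
    lazyStep S = (4 * (S.card : ℝ))⁻¹ • ∑ s ∈ S,
      inversion (1 + MonoidAlgebra.single s 1) * (1 + MonoidAlgebra.single s 1) := by
  have hc : (S.card : ℝ) ≠ 0 := by exact_mod_cast hS.card_pos.ne'
  have h1 : ∀ s : G, inversion (1 + MonoidAlgebra.single s (1 : ℝ)) *
      (1 + MonoidAlgebra.single s 1) = (2 : ℝ) • MonoidAlgebra.single 1 1 +
        (MonoidAlgebra.single s 1 + MonoidAlgebra.single s⁻¹ 1) := by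
    intro s
    rw [map_add, inversion_one, inversion_single, MonoidAlgebra.one_def, two_smul]
    simp only [add_mul, mul_add, MonoidAlgebra.single_mul_single, one_mul, mul_one, inv_mul_cancel]
    abel
  simp only [h1, Finset.sum_add_distrib, Finset.sum_const]
  rw [sum_comp_inv hS_symm fun s => MonoidAlgebra.single s (1 : ℝ), lazyStep,
    ← Nat.cast_smul_eq_nsmul ℝ, ← two_smul ℝ (∑ s ∈ S, _)]
  simp only [smul_add, smul_smul]
  congr 2
  · field_simp; norm_num
  · field_simp; norm_num

variable {B : Type*} [NormedAddCommGroup B] [InnerProductSpace ℝ B]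

/-- This is $\|a-b\|^2=\|a\|^2+\|b\|^2-2\langle a,b\rangle$ extended bilinearly. For $v=w$ of total
mass zero only the inner product survives, so the kernel is of negative type. -/
theorem linearExtension_inversion_mul {f : G → B} {ψ : G → ℝ}
    (hψ : ∀ x y, ψ (x⁻¹ * y) = ‖f x - f y‖ ^ 2) (v w : MonoidAlgebra ℝ G) :
    linearExtension ψ (inversion v * w) =
      augmentation G w * linearExtension (fun x => ‖f x‖ ^ 2) v +
        augmentation G v * linearExtension (fun x => ‖f x‖ ^ 2) w -
        2 * inner ℝ (linearExtension f v) (linearExtension f w) := by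
  induction v using MonoidAlgebra.induction_linear with
  | zero => simp
  | add v v' hv hv' =>
    simp only [map_add, add_mul, hv, hv', inner_add_left]
    ring
  | single g r =>
    induction w using MonoidAlgebra.induction_linear with
    | zero => simp
    | add w w' hw hw' =>
      simp only [map_add, mul_add, hw, hw', inner_add_right]
      ring
    | single g' r' =>
      simp only [inversion_single, MonoidAlgebra.single_mul_single, linearExtension_single,
        augmentation_single, hψ, smul_eq_mul, real_inner_smul_left, real_inner_smul_right,
        norm_sub_sq_real]
      ring

theorem linearExtension_inversion_mul_self_nonpos {f : G → B} {ψ : G → ℝ}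
    (hψ : ∀ x y, ψ (x⁻¹ * y) = ‖f x - f y‖ ^ 2) {v : MonoidAlgebra ℝ G}
    (hv : augmentation G v = 0) : linearExtension ψ (inversion v * v) ≤ 0 := by
  rw [linearExtension_inversion_mul hψ, hv, real_inner_self_eq_norm_sq]
  have := sq_nonneg ‖linearExtension f v‖
  linarith

/-- The element is the second difference of $k\mapsto P^{(k)}$, so this is concavity of
$k\mapsto\mathbb E\,\psi(X_k)$. With $w=P^{(j)}(1-P)$, which has mass zero, and $*$ for `inversion`,
it equals $w^*w$ for $k=2j$ and $w^*Pw$ for $k=2j+1$. Laziness settles the odd case: $P$ is a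
positive combination of the squares $(1+s)^*(1+s)$, by `lazyStep_eq_sum`. -/
theorem linearExtension_walk_mul_sq_nonpos {S : Finset G} (hS_symm : ∀ s ∈ S, s⁻¹ ∈ S)
    (hS : S.Nonempty) {f : G → B} {ψ : G → ℝ} (hψ : ∀ x y, ψ (x⁻¹ * y) = ‖f x - f y‖ ^ 2)
    (k : ℕ) : linearExtension ψ (walk S k * (1 - lazyStep S) ^ 2) ≤ 0 := by
  set P := lazyStep S with hP
  have haug : ∀ j, augmentation G (walk S j * (1 - P)) = 0 := fun j => by
    rw [map_mul, map_sub, map_one, augmentation_lazyStep hS, sub_self, mul_zero]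
  have hinv : ∀ j, inversion (walk S j * (1 - P)) = (1 - P) * walk S j := fun j => by
    rw [inversion_mul, inversion_walk hS_symm, map_sub, inversion_one, inversion_lazyStep hS_symm]
  have hcomm : ∀ j, Commute (1 - P) (walk S j) := fun j =>
    ((Commute.one_left P).sub_left (Commute.refl P)).pow_right j
  rcases Nat.even_or_odd' k with ⟨j, rfl | rfl⟩
  · have : walk S (2 * j) * (1 - P) ^ 2 =
        inversion (walk S j * (1 - P)) * (walk S j * (1 - P)) := by
      rw [hinv, (hcomm j).eq]
      rw [two_mul, walk, pow_add, ← walk, sq, mul_assoc, mul_assoc, ← mul_assoc (1 - P) (walk S j),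
        (hcomm j).eq, mul_assoc]
    rw [this]
    exact linearExtension_inversion_mul_self_nonpos hψ (haug j)
  · have : walk S (2 * j + 1) * (1 - P) ^ 2 =
        inversion (walk S j * (1 - P)) * P * (walk S j * (1 - P)) := by
      have h1 : P * walk S j = walk S j * P := (Commute.refl P).pow_right j
      have h2 : P * (1 - P) = (1 - P) * P := by simp [mul_sub, sub_mul]
      rw [hinv, (hcomm j).eq]
      rw [walk_succ, two_mul, walk, pow_add, ← walk, ← hP, sq]
      simp only [mul_assoc]
      rw [← mul_assoc P (walk S j), h1, ← mul_assoc (1 - P) (_ * _), ← mul_assoc (1 - P) (walk S j),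
        (hcomm j).eq]
      simp only [mul_assoc]
      rw [← mul_assoc P, h2, mul_assoc, h2]
    have hj := haug j
    generalize walk S j * (1 - P) = w at this hj
    rw [this, hP, lazyStep_eq_sum hS_symm hS, mul_smul_comm, smul_mul_assoc, Finset.mul_sum,
      Finset.sum_mul, map_smul, map_sum, smul_eq_mul]
    refine mul_nonpos_of_nonneg_of_nonpos (by positivity) (Finset.sum_nonpos fun s _ => ?_)
    have h3 := linearExtension_inversion_mul_self_nonpos hψ
      (v := (1 + MonoidAlgebra.single s 1) * w) (by rw [map_mul, hj, mul_zero])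
    rw [inversion_mul] at h3
    simpa only [mul_assoc] using h3

/-- A concave sequence starting at $0$ has every increment bounded by its first one. -/
theorem sum_walk_mul_norm_sub_sq_le {S : Finset G} (hS_symm : ∀ s ∈ S, s⁻¹ ∈ S)
    (hS : S.Nonempty) {f : G → B}
    (hf : ∀ g x y, ‖f (g * x) - f (g * y)‖ = ‖f x - f y‖) (n : ℕ) :
    ∑ x ∈ (walk S n).coeff.support, (walk S n).coeff x * ‖f 1 - f x‖ ^ 2 ≤
      n * ∑ x ∈ (walk S 1).coeff.support, (walk S 1).coeff x * ‖f 1 - f x‖ ^ 2 := by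
  set ψ : G → ℝ := fun x => ‖f 1 - f x‖ ^ 2 with hψdef
  have hψ : ∀ x y, ψ (x⁻¹ * y) = ‖f x - f y‖ ^ 2 := fun x y => by
    rw [hψdef]
    simp only
    rw [← hf x, mul_one, mul_inv_cancel_left]
  change linearExtension ψ (walk S n) ≤ n * linearExtension ψ (walk S 1)
  set Φ : ℕ → ℝ := fun n => linearExtension ψ (walk S n) with hΦ
  have h0 : Φ 0 = 0 := by simp [hΦ, MonoidAlgebra.one_def, hψdef]
  have hstep : ∀ k, Φ (k + 2) - Φ (k + 1) ≤ Φ (k + 1) - Φ k := by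
    intro k
    have h1 := linearExtension_walk_mul_sq_nonpos hS_symm hS hψ k
    have h2 : walk S k * (1 - lazyStep S) ^ 2 =
        walk S k - walk S (k + 1) - (walk S (k + 1) - walk S (k + 2)) := by
      simp only [walk_succ]
      noncomm_ring
    rw [h2, map_sub, map_sub, map_sub] at h1
    simp only [hΦ]
    linarith
  have hdiff : ∀ k, Φ (k + 1) - Φ k ≤ Φ 1 := by
    intro k
    induction k with
    | zero => simp [h0]
    | succ k ih => exact (hstep k).trans ih
  change Φ n ≤ n * Φ 1
  induction n with
  | zero => simp [h0]
  | succ n ih =>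
    have := hdiff n
    push_cast
    linarith

/-- Jensen's inequality for $t\mapsto t^{2c}$, convex because $c\ge1/2$, gives
$n^{2cd}\lesssim\mathbb E\|f(1)-f(X_n)\|^2\lesssim n$. -/
theorem two_mul_mul_le_of_compression {S : Finset G} (hS_symm : ∀ s ∈ S, s⁻¹ ∈ S)
    (hS : S.Nonempty) {f : G → B}
    (hf : ∀ g x y, ‖f (g * x) - f (g * y)‖ = ‖f x - f y‖)
    {k c d A : ℝ} (hk : 0 < k)
    (hc : 1 / 2 ≤ c) (hfc : ∀ x, 1 ≤ wordLength S x → k * (wordLength S x : ℝ) ^ c ≤ ‖f 1 - f x‖)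
    (hA : 0 < A) (hd : ∀ n : ℕ, 1 ≤ n → A * (n : ℝ) ^ d ≤ speed S n) : 2 * c * d ≤ 1 := by
  have hc0 : 0 < c := by linarith
  set D := ∑ x ∈ (walk S 1).coeff.support, (walk S 1).coeff x * ‖f 1 - f x‖ ^ 2 with hD
  refine le_of_forall_mul_rpow_le (A := k ^ 2 * A ^ (2 * c)) (B := D) (by positivity) fun n hn => ?_
  have hn0 : (0 : ℝ) < n := by exact_mod_cast hn
  have hjensen : speed S n ^ (2 * c) ≤ ∑ x ∈ (walk S n).coeff.support,
      (walk S n).coeff x * (wordLength S x : ℝ) ^ (2 * c) :=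
    Real.rpow_arith_mean_le_arith_mean_rpow _ _ _
      (fun x _ => walk_coeff_nonneg hS_symm hS n x) (sum_walk_coeff hS n)
      (fun x _ => Nat.cast_nonneg _) (by linarith)
  have hpt : ∀ x, k ^ 2 * (wordLength S x : ℝ) ^ (2 * c) ≤ ‖f 1 - f x‖ ^ 2 := by
    intro x
    rcases Nat.eq_zero_or_pos (wordLength S x) with h | h
    · rw [h, Nat.cast_zero, Real.zero_rpow (by positivity), mul_zero]
      positivity
    · have h1 := pow_le_pow_left₀ (by positivity) (hfc x h) 2
      rwa [mul_pow, ← Real.rpow_mul_natCast (Nat.cast_nonneg _), Nat.cast_ofNat, mul_comm c] at h1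
  rw [Real.rpow_one, mul_comm D]
  calc k ^ 2 * A ^ (2 * c) * (n : ℝ) ^ (2 * c * d)
      = k ^ 2 * (A * (n : ℝ) ^ d) ^ (2 * c) := by
        rw [Real.mul_rpow hA.le (by positivity), ← Real.rpow_mul hn0.le]
        ring_nf
    _ ≤ k ^ 2 * speed S n ^ (2 * c) := by
        gcongr
        exact hd n hn
    _ ≤ k ^ 2 * ∑ x ∈ (walk S n).coeff.support,
          (walk S n).coeff x * (wordLength S x : ℝ) ^ (2 * c) := by gcongr
    _ = ∑ x ∈ (walk S n).coeff.support,
          (walk S n).coeff x * (k ^ 2 * (wordLength S x : ℝ) ^ (2 * c)) := by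
        rw [Finset.mul_sum]
        exact Finset.sum_congr rfl fun x _ => by ring
    _ ≤ ∑ x ∈ (walk S n).coeff.support, (walk S n).coeff x * ‖f 1 - f x‖ ^ 2 :=
        Finset.sum_le_sum fun x _ =>
          mul_le_mul_of_nonneg_left (hpt x) (walk_coeff_nonneg hS_symm hS n x)
    _ ≤ n * D := sum_walk_mul_norm_sub_sq_le hS_symm hS hf n

end NegativeType

/-! ### Almost invariant unit vectors supported in balls -/

section Bump

variable {G : Type u} [Group G] {S : Finset G}

/-- Truncation at $0$ is $1$-Lipschitz, so the exponential's own increment is a bound; if $q>R$ then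
$p\ge R$ and both truncated values vanish. -/
theorem sq_sub_truncated_exp_le {a : ℝ} (ha : 0 ≤ a) {R p q : ℕ} (hpq : p ≤ q + 1)
    (hqp : q ≤ p + 1) :
    (max 0 (Real.exp (-(a * p)) - Real.exp (-(a * R))) -
      max 0 (Real.exp (-(a * q)) - Real.exp (-(a * R)))) ^ 2 ≤
      if q ≤ R then a ^ 2 * Real.exp (2 * a) * Real.exp (-(a * q)) ^ 2 else 0 := by
  have hzero : ∀ t : ℕ, R ≤ t → max 0 (Real.exp (-(a * t)) - Real.exp (-(a * R))) = 0 := by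
    intro t ht
    apply max_eq_left
    rw [sub_nonpos, Real.exp_le_exp, neg_le_neg_iff]
    gcongr
  split_ifs with h
  · have hp : (p : ℝ) ≤ q + 1 := by exact_mod_cast hpq
    have hq : (q : ℝ) ≤ p + 1 := by exact_mod_cast hqp
    have h1 : |max 0 (Real.exp (-(a * p)) - Real.exp (-(a * R))) -
        max 0 (Real.exp (-(a * q)) - Real.exp (-(a * R)))| ≤
        a * Real.exp a * Real.exp (-(a * q)) := by
      refine (abs_max_sub_max_le_max _ _ _ _).trans ?_
      rw [sub_self, abs_zero, max_eq_right (abs_nonneg _), sub_sub_sub_cancel_right]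
      have h2 : Real.exp (-(a * p)) = Real.exp (-(a * q)) * Real.exp (a * (q - p)) := by
        rw [← Real.exp_add]; ring_nf
      rw [h2, ← mul_sub_one, abs_mul, abs_of_pos (Real.exp_pos _), mul_comm]
      gcongr
      have hup : a * (q - p : ℝ) ≤ a := by nlinarith
      have hlow : -a ≤ a * (q - p : ℝ) := by nlinarith
      have h3 : 1 ≤ Real.exp a := Real.one_le_exp ha
      rw [abs_le]
      constructor
      · have := Real.add_one_le_exp (a * (q - p : ℝ))
        nlinarith
      · have h4 := Real.exp_le_exp.2 hup
        have h5 := Real.add_one_le_exp (-a)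
        have h6 : Real.exp (-a) * Real.exp a = 1 := by rw [← Real.exp_add]; simp
        nlinarith
    calc _ = |max 0 (Real.exp (-(a * p)) - Real.exp (-(a * R))) -
        max 0 (Real.exp (-(a * q)) - Real.exp (-(a * R)))| ^ 2 := (sq_abs _).symm
      _ ≤ (a * Real.exp a * Real.exp (-(a * q))) ^ 2 := by gcongr
      _ = _ := by
        rw [mul_pow, mul_pow, ← Real.exp_nat_mul a]
        norm_num
  · rw [hzero p (by omega), hzero q (by omega)]
    norm_num

/-- Take $\varphi=\max(0,e^{-a|x|}-e^{-aR})$ with $a=KR^{\nu-1}$. Its squared gradient is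
$O(a^2e^{-2a|x|})$ on $B_R$, and $e^{-2a|x|}\le2\varphi^2+2e^{-2aR}$. As $aR=KR^\nu$ matches the
growth rate, $|B_R|e^{-2aR}\le L$, which is controlled by $\|\varphi\|^2\ge\varphi(1)^2\ge\eta^2$.
-/
theorem exists_almost_invariant (hS_symm : ∀ s ∈ S, s⁻¹ ∈ S)
    (hconn : (SimpleGraph.mulCayley (S : Set G)).Connected)
    {K L ν : ℝ} (hK : 0 < K) (hL : 0 < L) (hν_pos : 0 < ν) (hν_le : ν ≤ 1)
    (hgrowth : ∀ n : ℕ, ((ball S n).ncard : ℝ) ≤ L * Real.exp (K * (n : ℝ) ^ ν)) :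
    ∃ C : ℝ, 0 < C ∧ ∀ R : ℕ, 1 ≤ R → ∃ (φ : G → ℝ) (F : Finset G),
      (∀ x, R ≤ wordLength S x → φ x = 0) ∧ ∑ x ∈ F, φ x ^ 2 = 1 ∧
      ∀ s ∈ S, ∀ F' : Finset G,
        ∑ x ∈ F', (φ (s⁻¹ * x) - φ x) ^ 2 ≤ C * ((R : ℝ) ^ (ν - 1)) ^ 2 := by
  classical
  set η : ℝ := 1 - Real.exp (-K) with hη
  have hη0 : 0 < η := by
    have : Real.exp (-K) < 1 := by simpa using hK
    linarith
  refine ⟨K ^ 2 * Real.exp (2 * K) * (2 + 2 * L / η ^ 2), by positivity, fun R hR => ?_⟩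
  have hR1 : (1 : ℝ) ≤ R := by exact_mod_cast hR
  have hR0 : (0 : ℝ) < R := by linarith
  set a : ℝ := K * (R : ℝ) ^ (ν - 1) with ha
  have ha0 : 0 < a := by positivity
  have haK : a ≤ K := by
    have : (R : ℝ) ^ (ν - 1) ≤ 1 := Real.rpow_le_one_of_one_le_of_nonpos hR1 (by linarith)
    nlinarith
  have haR : a * R = K * (R : ℝ) ^ ν := by
    rw [ha, Real.rpow_sub_one hR0.ne']; field_simp
  have hRν : 1 ≤ (R : ℝ) ^ ν := Real.one_le_rpow hR1 hν_pos.le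
  set φ : G → ℝ := fun x =>
    max 0 (Real.exp (-(a * wordLength S x)) - Real.exp (-(a * R))) with hφ
  have hfin := finite_ball S hS_symm hconn R
  set F := hfin.toFinset with hF
  have hmem : ∀ x, x ∈ F ↔ wordLength S x ≤ R := fun x => by
    rw [hF, Set.Finite.mem_toFinset]; rfl
  set N := ∑ x ∈ F, φ x ^ 2 with hN
  have hNη : η ^ 2 ≤ N := by
    have h1 : φ 1 ^ 2 ≤ N :=
      Finset.single_le_sum (f := fun x => φ x ^ 2) (fun x _ => sq_nonneg _) ((hmem 1).2 (by simp))
    refine le_trans ?_ h1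
    have h2 : Real.exp (-(a * R)) ≤ Real.exp (-K) := by
      rw [Real.exp_le_exp, haR]; nlinarith
    have h3 : η ≤ φ 1 := by
      rw [hφ]
      simp only [wordLength_one, Nat.cast_zero, mul_zero, neg_zero, Real.exp_zero]
      exact le_max_of_le_right (by linarith)
    gcongr
  have hN0 : 0 < N := (by positivity : 0 < η ^ 2).trans_le hNη
  have hgrad : ∀ s ∈ S, ∀ F' : Finset G, ∑ x ∈ F', (φ (s⁻¹ * x) - φ x) ^ 2 ≤
      K ^ 2 * Real.exp (2 * K) * (2 + 2 * L / η ^ 2) * ((R : ℝ) ^ (ν - 1)) ^ 2 * N := by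
    intro s hs F'
    have hlen : ∀ x, wordLength S (s⁻¹ * x) ≤ wordLength S x + 1 ∧
        wordLength S x ≤ wordLength S (s⁻¹ * x) + 1 := by
      intro x
      have h1 := wordLength_mul_le S hconn s⁻¹ x
      have h2 := wordLength_mul_le S hconn s (s⁻¹ * x)
      have h3 := wordLength_le_one S hs
      have h4 := wordLength_le_one S (hS_symm s hs)
      rw [mul_inv_cancel_left] at h2
      omega
    have hball : (F.card : ℝ) * Real.exp (-(a * R)) ^ 2 ≤ L := by
      have h1 : (F.card : ℝ) ≤ L * Real.exp (K * (R : ℝ) ^ ν) := by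
        have := hgrowth R
        rwa [Set.ncard_eq_toFinset_card _ hfin] at this
      calc (F.card : ℝ) * Real.exp (-(a * R)) ^ 2
          ≤ L * Real.exp (K * (R : ℝ) ^ ν) * Real.exp (-(a * R)) ^ 2 := by gcongr
        _ = L * Real.exp (-(a * R)) := by
            rw [haR, sq, mul_assoc, ← mul_assoc (Real.exp _), ← Real.exp_add, add_neg_cancel,
              Real.exp_zero, one_mul]
        _ ≤ L * 1 := by
            gcongr
            rw [Real.exp_le_one_iff]
            have := mul_pos ha0 hR0
            linarith
        _ = L := mul_one L
    calc ∑ x ∈ F', (φ (s⁻¹ * x) - φ x) ^ 2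
        ≤ ∑ x ∈ F', if wordLength S x ≤ R then
            a ^ 2 * Real.exp (2 * a) * Real.exp (-(a * wordLength S x)) ^ 2 else 0 :=
          Finset.sum_le_sum fun x _ => sq_sub_truncated_exp_le ha0.le (hlen x).1 (hlen x).2
      _ = ∑ x ∈ F' with wordLength S x ≤ R,
            a ^ 2 * Real.exp (2 * a) * Real.exp (-(a * wordLength S x)) ^ 2 :=
          (Finset.sum_filter _ _).symm
      _ ≤ ∑ x ∈ F, a ^ 2 * Real.exp (2 * a) * Real.exp (-(a * wordLength S x)) ^ 2 :=
          Finset.sum_le_sum_of_subset_of_nonneg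
            (fun x hx => (hmem x).2 (Finset.mem_filter.1 hx).2) fun x _ _ => by positivity
      _ ≤ ∑ x ∈ F, a ^ 2 * Real.exp (2 * a) *
            (2 * φ x ^ 2 + 2 * Real.exp (-(a * R)) ^ 2) := by
          refine Finset.sum_le_sum fun x hx => ?_
          gcongr
          have h1 : Real.exp (-(a * wordLength S x)) ≤ φ x + Real.exp (-(a * R)) := by
            have : _ ≤ φ x := le_max_right 0 (Real.exp (-(a * wordLength S x)) - Real.exp (-(a * R)))
            linarith
          calc Real.exp (-(a * wordLength S x)) ^ 2 ≤ (φ x + Real.exp (-(a * R))) ^ 2 := by gcongr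
            _ ≤ _ := by nlinarith [sq_nonneg (φ x - Real.exp (-(a * R)))]
      _ = a ^ 2 * Real.exp (2 * a) * (2 * N + 2 * (F.card * Real.exp (-(a * R)) ^ 2)) := by
          rw [← Finset.mul_sum, Finset.sum_add_distrib, ← Finset.mul_sum, Finset.sum_const,
            nsmul_eq_mul]
          ring
      _ ≤ a ^ 2 * Real.exp (2 * K) * (2 * N + 2 * (L / η ^ 2 * N)) := by
          have hball' : (F.card : ℝ) * Real.exp (-(a * R)) ^ 2 ≤ L / η ^ 2 * N := by
            refine hball.trans ?_
            rw [div_mul_eq_mul_div, le_div_iff₀ (by positivity)]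
            gcongr
          exact mul_le_mul (by gcongr) (by linarith) (by positivity) (by positivity)
      _ = _ := by rw [ha]; ring
  refine ⟨fun x => φ x / √N, F, fun x hx => ?_, ?_, fun s hs F' => ?_⟩
  · have : φ x = 0 := by
      apply max_eq_left
      rw [sub_nonpos, Real.exp_le_exp, neg_le_neg_iff]
      gcongr
    simp [this]
  · simp_rw [div_pow, Real.sq_sqrt hN0.le]
    rw [← Finset.sum_div, ← hN, div_self hN0.ne']
  · simp_rw [← sub_div, div_pow, Real.sq_sqrt hN0.le]
    rw [← Finset.sum_div, div_le_iff₀ hN0]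
    exact hgrad s hs F'

end Bump

/-! ### Affine isometric actions from formal coboundaries -/

section AffineAction

variable {G : Type u} [Group G] {ι : Type*}

/-- The left translation by `g` on the second coordinate of `ι × G`. -/
def translate (g : G) : ι × G ≃ ι × G := (Equiv.refl ι).prodCongr (Equiv.mulLeft g⁻¹)

@[simp] theorem translate_apply (g : G) (p : ι × G) : translate g p = (p.1, g⁻¹ * p.2) := rfl

theorem memℓp_comp_translate {F : ι × G → ℝ} (hF : Memℓp F 2) (g : G) :
    Memℓp (fun p => F (translate g p)) 2 := by
  rw [memℓp_gen_iff (by simp)] at hF ⊢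
  exact (translate g).summable_iff.2 hF

/-- The left regular representation of `G` on `ℓ²(ι × G)`. -/
noncomputable def regular (g : G) (v : lp (fun _ : ι × G => ℝ) 2) : lp (fun _ : ι × G => ℝ) 2 :=
  ⟨fun p => v (translate g p), memℓp_comp_translate (lp.memℓp v) g⟩

@[simp] theorem regular_apply (g : G) (v : lp (fun _ : ι × G => ℝ) 2) (p : ι × G) :
    regular g v p = v (translate g p) := rfl

theorem norm_regular (g : G) (v : lp (fun _ : ι × G => ℝ) 2) : ‖regular g v‖ = ‖v‖ := by
  rw [lp.norm_eq_tsum_rpow (by simp), lp.norm_eq_tsum_rpow (by simp)]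
  congr 1
  exact (translate g).tsum_eq fun p => ‖v p‖ ^ (2 : ENNReal).toReal

theorem regular_sub (g : G) (v w : lp (fun _ : ι × G => ℝ) 2) :
    regular g (v - w) = regular g v - regular g w := by
  ext p
  simp

variable (F : ι × G → ℝ)

/-- The formal coboundary `g ↦ λ_g F - F` of a function `F` that need not lie in `ℓ²`. -/
def coboundary (g : G) (p : ι × G) : ℝ := F (translate g p) - F p

theorem coboundary_mul (g h : G) (p : ι × G) :
    coboundary F (g * h) p = coboundary F h (translate g p) + coboundary F g p := by
  simp [coboundary, mul_assoc]

/-- By the cocycle identity and invariance of $\ell^2$ under translation, the elements with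
square-summable coboundary form a subgroup. -/
theorem memℓp_coboundary {S : Finset G} (hS_gen : Subgroup.closure (S : Set G) = ⊤)
    (hF : ∀ s ∈ S, Memℓp (coboundary F s) 2) (g : G) : Memℓp (coboundary F g) 2 := by
  have hg : g ∈ Subgroup.closure (S : Set G) := by rw [hS_gen]; trivial
  induction hg using Subgroup.closure_induction with
  | mem s hs => exact hF s hs
  | one =>
    have : coboundary F (1 : G) = 0 := by ext p; simp [coboundary]
    rw [this]
    exact zero_memℓp
  | mul a b _ _ ha hb =>
    have : coboundary F (a * b) =
        (fun p => coboundary F b (translate a p)) + coboundary F a := by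
      ext p; exact coboundary_mul F a b p
    rw [this]
    exact (memℓp_comp_translate hb a).add ha
  | inv a _ ha =>
    have : coboundary F a⁻¹ = -fun p => coboundary F a (translate a⁻¹ p) := by
      ext p; simp [coboundary]
    rw [this]
    exact (memℓp_comp_translate ha a⁻¹).neg

variable {F} (hF : ∀ g : G, Memℓp (coboundary F g) 2)

/-- The coboundary of `F` as a map to `ℓ²`. -/
def cocycle (g : G) : lp (fun _ : ι × G => ℝ) 2 := ⟨coboundary F g, hF g⟩

theorem cocycle_apply (g : G) (p : ι × G) : cocycle hF g p = coboundary F g p := rfl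

theorem cocycle_one : cocycle hF 1 = 0 := by
  ext p
  simp [cocycle_apply, coboundary]

theorem cocycle_mul (g h : G) : cocycle hF (g * h) = regular g (cocycle hF h) + cocycle hF g := by
  ext p
  exact coboundary_mul F g h p

theorem regular_mul_apply (g h : G) (v : lp (fun _ : ι × G => ℝ) 2) :
    regular (g * h) v = regular g (regular h v) := by
  ext p
  simp [mul_assoc]

theorem regular_one_apply (v : lp (fun _ : ι × G => ℝ) 2) : regular (1 : G) v = v := by
  ext p
  simp

theorem regular_add (g : G) (v w : lp (fun _ : ι × G => ℝ) 2) :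
    regular g (v + w) = regular g v + regular g w := by
  ext p
  simp

theorem affine_mul (g h : G) (v : lp (fun _ : ι × G => ℝ) 2) :
    regular (g * h) v + cocycle hF (g * h) =
      regular g (regular h v + cocycle hF h) + cocycle hF g := by
  rw [regular_mul_apply, cocycle_mul, regular_add, add_assoc]

/-- The affine isometric action `v ↦ λ_g v + b(g)` of `G` on `ℓ²(ι × G)`. -/
noncomputable def affineAction :
    G →* (lp (fun _ : ι × G => ℝ) 2 ≃ᵢ lp (fun _ : ι × G => ℝ) 2) :=
  MonoidHom.mk' (fun g =>
    { toFun := fun v => regular g v + cocycle hF g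
      invFun := fun v => regular g⁻¹ v + cocycle hF g⁻¹
      left_inv := fun v => by
        beta_reduce
        rw [← affine_mul, inv_mul_cancel, regular_one_apply, cocycle_one, add_zero]
      right_inv := fun v => by
        beta_reduce
        rw [← affine_mul, mul_inv_cancel, regular_one_apply, cocycle_one, add_zero]
      isometry_toFun := Isometry.of_dist_eq fun v w => by
        rw [dist_add_right, dist_eq_norm, dist_eq_norm, ← regular_sub, norm_regular] })
    fun g h => IsometryEquiv.ext fun v => affine_mul hF g h v

theorem cocycle_equivariant (g x : G) : cocycle hF (g * x) = affineAction hF g (cocycle hF x) :=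
  cocycle_mul hF g x

theorem norm_cocycle_sub (x y : G) :
    ‖cocycle hF x - cocycle hF y‖ = ‖cocycle hF (y⁻¹ * x)‖ := by
  have h := cocycle_equivariant hF y (y⁻¹ * x)
  have h' := cocycle_equivariant hF y 1
  rw [mul_inv_cancel_left] at h
  rw [mul_one] at h'
  rw [h, h', ← dist_eq_norm, (affineAction hF y).isometry.dist_eq, cocycle_one, dist_zero_right]

theorem exists_norm_cocycle_le {S : Finset G} (hS_symm : ∀ s ∈ S, s⁻¹ ∈ S)
    (hconn : (SimpleGraph.mulCayley (S : Set G)).Connected) :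
    ∃ C : ℝ, 0 < C ∧ ∀ g, ‖cocycle hF g‖ ≤ C * wordLength S g := by
  refine ⟨1 + ∑ s ∈ S, ‖cocycle hF s‖, by positivity, fun g => ?_⟩
  generalize hn : wordLength S g = n
  induction n generalizing g with
  | zero =>
    rw [(wordLength_eq_zero_iff S hconn).1 hn, cocycle_one]
    simp
  | succ n ih =>
    obtain ⟨x, s, hs, hx, rfl⟩ := exists_mul_of_wordLength_eq_succ S hS_symm hconn hn
    have h1 : ‖cocycle hF s‖ ≤ ∑ s ∈ S, ‖cocycle hF s‖ :=
      Finset.single_le_sum (f := fun s => ‖cocycle hF s‖) (fun _ _ => norm_nonneg _) hs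
    have h2 := ih x hx
    rw [cocycle_mul]
    refine (norm_add_le _ _).trans ?_
    rw [norm_regular]
    push_cast
    linarith

end AffineAction

/-! ### Lower bound for the compression exponent -/

section Compression

variable {G : Type u} [Group G] {S : Finset G}

theorem exponentOf_nonneg (ρ : ℝ≥0 → ℝ≥0) : 0 ≤ exponentOf ρ :=
  Real.sSup_nonneg fun _ hc => hc.1.1

theorem exponentOf_le_one (ρ : ℝ≥0 → ℝ≥0) : exponentOf ρ ≤ 1 :=
  Real.sSup_le (fun _ hc => hc.1.2) zero_le_one

theorem le_exponentOf {ρ : ℝ≥0 → ℝ≥0} {c K : ℝ} (hc : c ∈ Set.Icc (0 : ℝ) 1) (hK : 0 < K)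
    (h : ∀ n : ℕ, 1 ≤ n → K * (n : ℝ) ^ c ≤ (ρ (n : ℝ≥0) : ℝ)) : c ≤ exponentOf ρ :=
  le_csSup ⟨1, fun _ hd => hd.1.2⟩ ⟨hc, K, hK, h⟩

theorem compressionExponent_nonneg : 0 ≤ compressionExponent S :=
  Real.sSup_nonneg fun _ ⟨_, _, _, _, _, _, ρ, _, ha⟩ => ha ▸ exponentOf_nonneg ρ

theorem exponentOf_le_compressionExponent {B : Type u} [NormedAddCommGroup B]
    [InnerProductSpace ℝ B] [CompleteSpace B] {π : G →* (B ≃ᵢ B)} {f : G → B} {ρ : ℝ≥0 → ℝ≥0}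
    (h : IsEquivariantUniformEmbedding S π f ρ) : exponentOf ρ ≤ compressionExponent S :=
  le_csSup ⟨1, fun _ ⟨_, _, _, _, _, _, ρ, _, ha⟩ => ha ▸ exponentOf_le_one ρ⟩
    ⟨B, ‹_›, ‹_›, ‹_›, π, f, ρ, h, rfl⟩

/-- Any loss $\varepsilon$ in the exponent pays for the factor $k+1$ that makes the dyadic sum
converge. -/
theorem exists_mul_succ_le_rpow {ε : ℝ} (hε : 0 < ε) :
    ∃ c : ℝ, 0 < c ∧ ∀ k : ℕ, c * (k + 1) ≤ ((2 : ℝ) ^ k) ^ ε := by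
  have hlog : 0 < Real.log 2 := Real.log_pos one_lt_two
  refine ⟨min 1 (ε * Real.log 2), by positivity, fun k => ?_⟩
  have h1 : ((2 : ℝ) ^ k) ^ ε = Real.exp (ε * Real.log 2 * k) := by
    rw [Real.rpow_def_of_pos (by positivity), Real.log_pow]
    ring_nf
  rw [h1]
  have h2 := Real.add_one_le_exp (ε * Real.log 2 * k)
  have h3 : min 1 (ε * Real.log 2) * k ≤ ε * Real.log 2 * k := by
    gcongr
    exact min_le_right _ _
  have h4 := min_le_left 1 (ε * Real.log 2)
  linarith

theorem exists_cocycle_growth (hS_symm : ∀ s ∈ S, s⁻¹ ∈ S)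
    (hS_gen : Subgroup.closure (S : Set G) = ⊤)
    {K L ν : ℝ} (hK : 0 < K) (hL : 0 < L) (hν_pos : 0 < ν) (hν_le : ν ≤ 1)
    (hgrowth : ∀ n : ℕ, ((ball S n).ncard : ℝ) ≤ L * Real.exp (K * (n : ℝ) ^ ν)) :
    ∃ (F : ℕ × G → ℝ) (hF : ∀ g : G, Memℓp (coboundary F g) 2), ∀ (k : ℕ) (g : G),
      2 ^ (k + 1) ≤ wordLength S g + 1 →
        ((2 : ℝ) ^ k) ^ (1 - ν) / (k + 1) ≤ ‖cocycle hF g‖ := by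
  classical
  have hconn := connected_mulCayley S hS_gen
  obtain ⟨C, hC, hφ⟩ := exists_almost_invariant hS_symm hconn hK hL hν_pos hν_le hgrowth
  choose φ A hφ0 hφ1 hφC using fun k : ℕ => hφ (2 ^ k) Nat.one_le_two_pow
  -- The power cancels the gradient bound at scale $2^k$ exactly, leaving the summable $C/(k+1)^2$.
  set w : ℕ → ℝ := fun k => ((2 : ℝ) ^ k) ^ (1 - ν) / (k + 1) with hw
  set F : ℕ × G → ℝ := fun p => w p.1 * φ p.1 p.2 with hFdef
  have hcob : ∀ g k x, coboundary F g (k, x) = w k * (φ k (g⁻¹ * x) - φ k x) := fun g k x => by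
    simp only [coboundary, translate_apply, hFdef]
    ring
  have hsq : Summable fun k : ℕ => C * (1 / ((k : ℝ) + 1) ^ 2) := by
    have := (summable_nat_add_iff 1).2 (Real.summable_one_div_nat_pow.2 one_lt_two)
    exact (by simpa using this : Summable fun k : ℕ => 1 / ((k : ℝ) + 1) ^ 2).mul_left C
  have hgen : ∀ s ∈ S, Memℓp (coboundary F s) 2 := by
    intro s hs
    refine memℓp_gen' (C := ∑' k : ℕ, C * (1 / ((k : ℝ) + 1) ^ 2)) fun T => ?_
    calc ∑ p ∈ T, ‖coboundary F s p‖ ^ (2 : ENNReal).toReal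
        = ∑ p ∈ T, coboundary F s p ^ 2 := by
          refine Finset.sum_congr rfl fun p _ => ?_
          rw [ENNReal.toReal_ofNat, Real.rpow_two, Real.norm_eq_abs, sq_abs]
      _ ≤ ∑ p ∈ T.image Prod.fst ×ˢ T.image Prod.snd, coboundary F s p ^ 2 :=
          Finset.sum_le_sum_of_subset_of_nonneg Finset.subset_product fun p _ _ => sq_nonneg _
      _ = ∑ k ∈ T.image Prod.fst, w k ^ 2 *
            ∑ x ∈ T.image Prod.snd, (φ k (s⁻¹ * x) - φ k x) ^ 2 := by
          rw [Finset.sum_product]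
          refine Finset.sum_congr rfl fun k _ => ?_
          rw [Finset.mul_sum]
          exact Finset.sum_congr rfl fun x _ => by rw [hcob, mul_pow]
      _ ≤ ∑ k ∈ T.image Prod.fst, C * (1 / ((k : ℝ) + 1) ^ 2) := by
          refine Finset.sum_le_sum fun k _ => ?_
          refine (mul_le_mul_of_nonneg_left (hφC k s hs _) (sq_nonneg _)).trans_eq ?_
          have h1 : ((2 : ℝ) ^ k) ^ (1 - ν) * ((2 : ℝ) ^ k) ^ (ν - 1) = 1 := by
            rw [← Real.rpow_add (by positivity)]
            ring_nf
            exact Real.rpow_zero _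
          simp only [hw, Nat.cast_pow, Nat.cast_ofNat]
          calc _ = C * (1 / ((k : ℝ) + 1) ^ 2) *
                (((2 : ℝ) ^ k) ^ (1 - ν) * ((2 : ℝ) ^ k) ^ (ν - 1)) ^ 2 := by
                rw [one_div, ← inv_pow]
                ring
            _ = _ := by rw [h1, one_pow, mul_one]
      _ ≤ _ := hsq.sum_le_tsum _ fun k _ => by positivity
  refine ⟨F, memℓp_coboundary F hS_gen hgen, fun k g hg => ?_⟩
  have hsum := lp.sum_rpow_le_norm_rpow (by simp)
    (cocycle (memℓp_coboundary F hS_gen hgen) g) ((A k).map ⟨fun x => (k, x), fun x y h => by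
      simpa using h⟩)
  simp only [ENNReal.toReal_ofNat, Real.rpow_two, Finset.sum_map,
    cocycle_apply, Real.norm_eq_abs, sq_abs] at hsum
  have hterm : ∀ x, w k ^ 2 * φ k x ^ 2 ≤ coboundary F g (k, x) ^ 2 := by
    intro x
    rw [hcob, mul_pow]
    refine mul_le_mul_of_nonneg_left ?_ (sq_nonneg _)
    by_cases hx : 2 ^ k ≤ wordLength S x
    · rw [hφ0 k x hx, zero_pow two_ne_zero]
      exact sq_nonneg _
    -- The support of `φ k` lies in $|x|\le2^k-1$, so $|g|\ge2^{k+1}-1$ already makes it disjoint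
    -- from its translate by $g$.
    · have h1 : φ k (g⁻¹ * x) = 0 := by
        apply hφ0
        have h2 := wordLength_mul_le S hconn x (g⁻¹ * x)⁻¹
        have h3 := wordLength_inv S hconn (g⁻¹ * x)
        rw [mul_inv_rev, inv_inv, mul_inv_cancel_left] at h2
        rw [mul_inv_rev, inv_inv] at h3
        rw [pow_succ] at hg
        omega
      rw [h1, zero_sub, neg_sq]
  have hle : w k ^ 2 ≤ ‖cocycle (memℓp_coboundary F hS_gen hgen) g‖ ^ 2 := by
    refine le_trans ?_ hsum
    calc w k ^ 2 = ∑ x ∈ A k, w k ^ 2 * φ k x ^ 2 := by rw [← Finset.mul_sum, hφ1, mul_one]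
      _ ≤ _ := Finset.sum_le_sum fun x _ => hterm x
  exact le_of_sq_le_sq hle (norm_nonneg _)

theorem le_compressionExponent (hS_symm : ∀ s ∈ S, s⁻¹ ∈ S)
    (hS_gen : Subgroup.closure (S : Set G) = ⊤)
    {K L ν : ℝ} (hK : 0 < K) (hL : 0 < L) (hν_pos : 0 < ν) (hν_le : ν ≤ 1)
    (hgrowth : ∀ n : ℕ, ((ball S n).ncard : ℝ) ≤ L * Real.exp (K * (n : ℝ) ^ ν)) :
    1 - ν ≤ compressionExponent S := by
  refine le_of_forall_lt fun e he => ?_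
  obtain ⟨e', hee', he'⟩ := exists_between he
  refine hee'.trans_le ?_
  rcases le_or_gt e' 0 with h0 | h0
  · exact h0.trans compressionExponent_nonneg
  have hconn := connected_mulCayley S hS_gen
  obtain ⟨F, hF, hlow⟩ := exists_cocycle_growth hS_symm hS_gen hK hL hν_pos hν_le hgrowth
  obtain ⟨C, hC, hup⟩ := exists_norm_cocycle_le hF hS_symm hconn
  obtain ⟨c, hc, hck⟩ := exists_mul_succ_le_rpow (sub_pos.2 he')
  -- The $4^{e'}$ comes from $|g|\le4\cdot2^k$ at the largest scale $k$ usable for $g$.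
  set κ : ℝ := c / 4 ^ e' with hκ
  have hκ0 : 0 < κ := by positivity
  have hlower : ∀ g : G, κ * (wordLength S g : ℝ) ^ e' ≤ ‖cocycle hF g‖ := by
    intro g
    rcases Nat.eq_zero_or_pos (wordLength S g) with hg | hg
    · rw [hg, Nat.cast_zero, Real.zero_rpow h0.ne', mul_zero]
      positivity
    · obtain ⟨k, hk⟩ : ∃ k, Nat.log 2 (wordLength S g + 1) = k + 1 :=
        Nat.exists_eq_succ_of_ne_zero (Nat.log_pos one_lt_two (by omega)).ne'
      have h1 : 2 ^ (k + 1) ≤ wordLength S g + 1 := hk ▸ Nat.pow_log_le_self 2 (by omega)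
      have h2 : wordLength S g + 1 < 2 ^ (k + 1 + 1) := hk ▸ Nat.lt_pow_succ_log_self one_lt_two _
      have h3 : (wordLength S g : ℝ) ≤ 4 * 2 ^ k := by
        have : wordLength S g ≤ 4 * 2 ^ k := by
          rw [pow_succ, pow_succ] at h2
          omega
        exact_mod_cast this
      refine le_trans ?_ (hlow k g h1)
      rw [le_div_iff₀ (by positivity)]
      calc κ * (wordLength S g : ℝ) ^ e' * (k + 1) ≤ κ * (4 * 2 ^ k) ^ e' * (k + 1) := by gcongr
        _ = c * (k + 1) * ((2 : ℝ) ^ k) ^ e' := by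
            rw [Real.mul_rpow (by norm_num) (by positivity), hκ]
            field_simp
        _ ≤ ((2 : ℝ) ^ k) ^ (1 - ν - e') * ((2 : ℝ) ^ k) ^ e' := by
            gcongr
            exact hck k
        _ = ((2 : ℝ) ^ k) ^ (1 - ν) := by
            rw [← Real.rpow_add (by positivity), sub_add_cancel]
  set ρ : ℝ≥0 → ℝ≥0 := fun t => κ.toNNReal * t ^ e' with hρ
  have hρ_coe : ∀ t : ℝ≥0, (ρ t : ℝ) = κ * (t : ℝ) ^ e' := fun t => by
    simp [hρ, hκ0.le]
  have hκ' : 0 < κ.toNNReal := Real.toNNReal_pos.2 hκ0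
  have hemb : IsEquivariantUniformEmbedding S (affineAction hF) (cocycle hF) ρ :=
    { monotone := fun s t hst => mul_le_mul_right (NNReal.rpow_le_rpow hst h0.le) _
      unbounded := by
        rintro ⟨M, hM⟩
        have h1 := hM ⟨((M + 1) / κ.toNNReal) ^ (1 / e'), rfl⟩
        simp only [hρ] at h1
        rw [← NNReal.rpow_mul, one_div_mul_cancel h0.ne', NNReal.rpow_one,
          mul_div_cancel₀ _ hκ'.ne'] at h1
        exact absurd h1 (not_le.2 (lt_add_one M))
      lower := fun x y => by
        rw [norm_cocycle_sub, hρ_coe, NNReal.coe_natCast]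
        exact hlower _
      upper := ⟨C, hC, fun x y => by
        rw [norm_cocycle_sub]
        have := hup (y⁻¹ * x)
        linarith⟩
      equivariant := cocycle_equivariant hF }
  exact (le_exponentOf ⟨h0.le, by linarith⟩ hκ0 fun n _ => by
    rw [hρ_coe, NNReal.coe_natCast]).trans (exponentOf_le_compressionExponent hemb)

end Compression

/-! ### Passing to the exponents -/

section Exponents

variable {G : Type u} [Group G] {S : Finset G}

theorem le_speedExponent {c K : ℝ} (hc : c ∈ Set.Icc (0 : ℝ) 1) (hK : 0 < K)
    (h : ∀ n : ℕ, 1 ≤ n → K * (n : ℝ) ^ c ≤ speed S n) : c ≤ speedExponent S :=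
  le_csSup ⟨1, fun _ hd => hd.1.2⟩ ⟨hc, K, hK, h⟩

theorem speedExponent_nonneg : 0 ≤ speedExponent S :=
  Real.sSup_nonneg fun _ hc => hc.1.1

theorem speedExponent_le {C d : ℝ} (hd : 0 ≤ d)
    (h : ∀ n : ℕ, speed S n ≤ C * (n : ℝ) ^ d) : speedExponent S ≤ d :=
  Real.sSup_le (fun _ ⟨_, _, hK, hc⟩ =>
    le_of_forall_mul_rpow_le hK fun n hn => (hc n hn).trans (h n)) hd

theorem mul_compressionExponent_le (hS_symm : ∀ s ∈ S, s⁻¹ ∈ S) (hS : S.Nonempty)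
    {h ν A : ℝ} (hh : 0 < h) (hν_pos : 0 < ν) (hhν : h ≤ ν) (hA : 0 < A)
    (hspeed : ∀ n : ℕ, 1 ≤ n → A * (n : ℝ) ^ (h / ν) ≤ speed S n) :
    2 * h * compressionExponent S ≤ ν := by
  have key : compressionExponent S ≤ ν / (2 * h) := by
    refine Real.sSup_le ?_ (by positivity)
    rintro _ ⟨B, _, _, _, π, f, ρ, hemb, rfl⟩
    refine Real.sSup_le ?_ (by positivity)
    rintro c ⟨-, k, hk, hρ⟩
    rw [le_div_iff₀ (by positivity)]
    -- Below $1/2$ Jensen's inequality is unavailable, but $2hc\le h\le\nu$ directly.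
    rcases le_total c (1 / 2) with hc | hc
    · nlinarith
    · have hf : ∀ g x y, ‖f (g * x) - f (g * y)‖ = ‖f x - f y‖ := fun g x y => by
        rw [hemb.equivariant, hemb.equivariant, ← dist_eq_norm, (π g).isometry.dist_eq,
          dist_eq_norm]
      have hfc : ∀ x, 1 ≤ wordLength S x → k * (wordLength S x : ℝ) ^ c ≤ ‖f 1 - f x‖ := by
        intro x hx
        have h1 := hemb.lower x 1
        rw [inv_one, one_mul, norm_sub_rev] at h1
        exact (hρ _ hx).trans h1
      have h2 := two_mul_mul_le_of_compression hS_symm hS hf hk hc hfc hA hspeed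
      rw [mul_div_assoc', div_le_one hν_pos] at h2
      linarith
  rw [le_div_iff₀ (by positivity)] at key
  linarith

end Exponents

end LazyWalk

theorem theorem1p3 {G : Type u} [Group G] (S : Finset G) (hS_nonempty : S.Nonempty)
    (hS_symm : ∀ s ∈ S, s⁻¹ ∈ S) (hS_gen : Subgroup.closure (S : Set G) = ⊤)
    (K L ν : ℝ) (hK : 0 < K) (hL : 0 < L) (hν_pos : 0 < ν) (hν_le : ν ≤ 1)
    (hgrowth : ∀ n : ℕ, ((LazyWalk.ball S n).ncard : ℝ) ≤ L * Real.exp (K * (n : ℝ) ^ ν)) :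
    -- (a)
    ((∃ K' : ℝ, 0 < K' ∧
        ∀ n : ℕ, LazyWalk.speed S n ≤ K' * (n : ℝ) ^ (1 / (2 - ν))) ∧
      LazyWalk.speedExponent S ≤ 1 / (2 - ν) ∧
      (∃ L'' K'' : ℝ, 0 < L'' ∧ 0 < K'' ∧
        ∀ n : ℕ, LazyWalk.entropy S n ≤ L'' + K'' * (n : ℝ) ^ (ν / (2 - ν)))) ∧
    -- (b)
    1 - ν ≤ LazyWalk.compressionExponent S ∧
    -- (c)
    (∀ h : ℝ,
      (∃ K' L' : ℝ, 0 < K' ∧ 0 < L' ∧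
        ∀ n : ℕ, 1 ≤ n → K' + L' * (n : ℝ) ^ h ≤ LazyWalk.entropy S n) →
      h ≤ LazyWalk.speedExponent S * ν ∧
        2 * h * LazyWalk.compressionExponent S ≤ ν) := by
  have hconn := LazyWalk.connected_mulCayley S hS_gen
  obtain ⟨C, hC, hspeed, hent⟩ := LazyWalk.exists_speed_le_and_entropy_le hS_symm hS_nonempty hconn
    hK hL hν_pos hν_le hgrowth
  have h2ν : 0 < 2 - ν := by linarith
  have hent0 : LazyWalk.entropy S 0 = 0 :=
    LazyWalk.entropy_eq_zero_of_speed_eq_zero hS_symm hS_nonempty hconn LazyWalk.speed_zero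
  refine ⟨⟨⟨C, hC, hspeed⟩, LazyWalk.speedExponent_le (by positivity) hspeed, 1, C, one_pos, hC,
    fun n => ?_⟩, LazyWalk.le_compressionExponent hS_symm hS_gen hK hL hν_pos hν_le hgrowth, ?_⟩
  · rcases Nat.eq_zero_or_pos n with rfl | hn
    · rw [hent0]
      positivity
    · have := hent n hn
      linarith
  · rintro h ⟨K', L', hK', hL', hlow⟩
    rcases le_or_gt h 0 with hh | hh
    · have h1 := LazyWalk.speedExponent_nonneg (S := S)
      have h2 := LazyWalk.compressionExponent_nonneg (S := S)
      exact ⟨hh.trans (by positivity), by nlinarith⟩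
    · have hlow' : ∀ n : ℕ, 1 ≤ n → L' * (n : ℝ) ^ h ≤ LazyWalk.entropy S n := fun n hn => by
        have := hlow n hn
        linarith
      -- The entropy bound of (a) forces this; it puts $h/\nu$ in $[0,1]$, where the supremum
      -- defining $\beta$ is taken.
      have hhν : h ≤ ν := by
        have h1 : h ≤ ν / (2 - ν) :=
          LazyWalk.le_of_forall_mul_rpow_le hL' fun n hn => (hlow' n hn).trans (hent n hn)
        exact h1.trans (div_le_self hν_pos.le (by linarith))
      obtain ⟨A, hA, hA_speed⟩ := LazyWalk.exists_le_speed hS_symm hS_nonempty hconn hK hL hν_pos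
        hν_le hgrowth hh hL' hlow'
      refine ⟨?_, LazyWalk.mul_compressionExponent_le hS_symm hS_nonempty hh hν_pos hhν hA
        hA_speed⟩
      rw [← div_le_iff₀ hν_pos]
      exact LazyWalk.le_speedExponent ⟨by positivity, (div_le_one hν_pos).2 hhν⟩ hA hA_speed
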